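/- Let $R$ be a finite commutative local ring with maximal ideal $\mathfrak m$, of characteristic $p^{\varsigma}$ and with $|R/\mathfrak m|=p^{\mu}$. Let $R_0$ be a maximal Galois subring of $R$, i.e. a subring isomorphic to the Galois ring $(\mathbb Z/p^{\varsigma})[X]/(h)$ with $h$ monic of degree $\mu$ and irreducible modulo $p$. Let $\gamma=\mathrm{rk}_{R_0}(R)$ be the least number of generators of $R$ as an $R_0$-module, and fix $z_1,\dots,z_\gamma\in R$ with $R=R_0z_1\oplus\cdots\oplus R_0z_\gamma$. Let $S$ be a Galois extension of $R$ of dimension $m$, i.e. a local ring that is free of rank $m$ over $R$ and has maximal ideal $\mathfrak mS$. Elements of $S$ are represented by their coordinates in an $R$-basis $1,\theta,\dots,\theta^{m-1}$ of $S$, and the coordinates of $\theta^m$ are given. The rank $\mathrm{rk}$ of a module is its least number of generators, and the free rank $\mathrm{frk}$ is the largest rank of a free submodule. For a vector $u$ over $S$, its support is the $R$-submodule of $S$ spanned by its entries. Let $0<k<n$ and $\lambda>0$, let $\mathcal F\subseteq S$ be a free $R$-submodule of rank $\lambda$ with basis $f_1,\dots,f_\lambda$, and let $H\in S^{(n-k)\times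 n}$ be an LRPC parity-check matrix: its row module has free rank $n-k$ over $S$ and its entries generate $\mathcal F$ over $R$. The decoding algorithm over local rings takes $H$, $f_1,\dots,f_\lambda$ and a word $r\in S^n$, and does the following. 1. Compute the syndrome $s=rH^{T}$. If $s=0$, return $r$. 2. Let $\mathcal S$ be the support of $s$. If $\mathcal S$ is not free over $R$, fail. Otherwise find a basis of $\mathcal S$ and put $\nu=\mathrm{frk}_R(\mathcal S)$. If $\lambda\nmid\nu$, fail. Put $t'=\nu/\lambda$. 3. Compute $\mathcal S_i=f_i^{-1}\mathcal S$ for $1\le i\le\lambda$ and $\mathcal E'=\bigcap_{i=1}^{\lambda}\mathcal S_i$ (by generators). 4. If $\mathcal E'$ is not free, fail. Otherwise find a basis of $\mathcal E'$. If $\mathrm{frk}_R(\mathcal E')\ne t'$ or $\mathrm{frk}_R(\mathcal E'\mathcal F)\neq\nu$, where $\mathcal E'\mathcal F$ is the $R$-module generated by the products, fail. 5. If there is $e'\in S^n$ with support $\mathcal E'$ and $He'^{T}=s^{T}$, find such an $e'$ and return $r-e'$. Otherwise fail. Assume that the inverses $f_i^{-1}$ are precomputed. The operations in $R$, each of unit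 cost, are: the constant $1$, addition, subtraction, multiplication, inversion of a unit (with value $0$ on non-units), the test whether an element is zero, and the basic operations over $R_0$: extracting the precomputed coefficients $r_1,\dots,r_\gamma\in R_0$ of $r=\sum_i r_iz_i$, dividing in $R_0$ (a quotient $c \in R_0$ with $yc=x$ for $x,y\in R_0$, if there is one, and $0$ otherwise), and taking a generator of the annihilator in $R_0$ of an element of $R$. **Theorem.** The decoding algorithm costs $\mathcal O\left(\lambda\gamma^4mn\max\{n^2,m^2\}\right)$ operations in $R$. That is, there is an absolute constant $C$ such that for all sizes $(m,n,k,\lambda,\gamma)$ there is a computation tree over these operations, depending on the sizes only, which for all data $R,S,\theta,R_0,(z_i),\mathcal F,H,(f_i),r$ of these sizes executes the algorithm, i.e. computes all the objects named in the steps up to the exit and the result, with at most $C\lambda\gamma^4mn\max\{n^2,m^2\}$ operations. -/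

import Mathlib

open Polynomial Matrix

/-! Ring theory: free rank, Galois extensions, maximal Galois subrings -/

/-- The free rank of an `A`-module `M`: the largest rank of a free submodule. -/
noncomputable def freeRank (A M : Type*) [CommRing A] [AddCommGroup M] [Module A M] : ℕ :=
  sSup {r | ∃ N : Submodule A M, Module.Free A N ∧ Module.finrank A N = r}

/-- `S` is a Galois extension of dimension `m` of the finite local ring `R`: a local ring, free of
rank `m` over `R`, whose maximal ideal is generated by that of `R` (the extension of the residue
fields is then an extension of finite fields of degree `m`, hence Galois). -/
structure IsGaloisExtension (R S : Type*) [CommRing R] [IsLocalRing R] [CommRing S] [Algebra R S]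
    (m : ℕ) : Prop where
  isLocalRing : IsLocalRing S
  free : Module.Free R S
  finrank_eq : Module.finrank R S = m
  map_maximalIdeal : (IsLocalRing.maximalIdeal R).map (algebraMap R S) =
    @IsLocalRing.maximalIdeal S _ isLocalRing

/-- `R₀` is a maximal Galois subring of the finite local ring `R`: if `R` has characteristic
`p ^ e` and residue field of cardinality `p ^ d`, then `R₀` is isomorphic to the Galois ring of
characteristic `p ^ e` and cardinality `p ^ (d * e)`, that is to `(ℤ / p ^ e)[X] / (h)` with `h`
monic of degree `d` and irreducible modulo `p`. -/
def IsMaximalGaloisSubring {R : Type*} [CommRing R] [IsLocalRing R] (R₀ : Subring R) : Prop :=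
  ∃ (p e d : ℕ) (he : e ≠ 0) (h : (ZMod (p ^ e))[X]),
    p.Prime ∧ CharP R (p ^ e) ∧ Nat.card (IsLocalRing.ResidueField R) = p ^ d ∧
    h.Monic ∧ h.natDegree = d ∧
    Irreducible (h.map (ZMod.castHom (dvd_pow_self p he) (ZMod p))) ∧
    Nonempty (R₀ ≃+* AdjoinRoot h)

/-! LRPC codes -/

/-- The support of a vector with entries in `S`: the `R`-submodule that its entries span. -/
def vecSupport (R : Type*) {S ι : Type*} [CommRing R] [CommRing S] [Algebra R S] (u : ι → S) :
    Submodule R S :=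
  Submodule.span R (Set.range u)

/-- `H` is a parity-check matrix of an LRPC code with parameters `k`, `n`, `lam`: the entries of
`H` generate the free `R`-module `F` of rank `lam`, and the rows of `H` have free rank `n - k`
over `S`. -/
structure IsLRPC (R : Type*) {S : Type*} [CommRing R] [CommRing S] [Algebra R S] (k n lam : ℕ)
    (F : Submodule R S) (H : Matrix (Fin (n - k)) (Fin n) S) : Prop where
  k_pos : 0 < k
  k_lt : k < n
  lam_pos : 0 < lam
  free : Module.Free R F
  finrank_eq : Module.finrank R F = lam
  freeRank_rows : freeRank S (Submodule.span S (Set.range H.row)) = n - k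
  span_entries : Submodule.span R {x | ∃ i j, x = H i j} = F

/-! The decoding algorithm -/

/-- The integer parameters: `m = rk_R S`, length `n`, dimension `k`, rank `lam` of `F` and
`gam = rk_{R₀} R`. -/
structure Sizes where
  m : ℕ
  n : ℕ
  k : ℕ
  lam : ℕ
  gam : ℕ

/-- The record of one run of the decoding algorithm: the objects computed on the way, and the exit
through which the run ends. `A` is the type of (representations of) elements of `S`. The vector
`s` is the syndrome, `bs` a basis of its support, `gi i` generates the `i`-th shifted support, `g`
generates their intersection, `be` is a basis of the intersection, `e` is the error vector found,
and `out` is the word returned. All exits except `zeroSyndrome` and `success` return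
"decoding failure". -/
inductive Trace (d : Sizes) (A : Type*)
  | zeroSyndrome (s : Fin (d.n - d.k) → A) (out : Fin d.n → A)
  | supportNotFree (s : Fin (d.n - d.k) → A)
  | rankNotDivisible (s : Fin (d.n - d.k) → A) (bs : List A)
  | intersectionNotFree (s : Fin (d.n - d.k) → A) (bs : List A) (gi : Fin d.lam → List A)
      (g : List A)
  | rankMismatch (s : Fin (d.n - d.k) → A) (bs : List A) (gi : Fin d.lam → List A)
      (g be : List A)
  | noErasureSolution (s : Fin (d.n - d.k) → A) (bs : List A) (gi : Fin d.lam → List A)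
      (g be : List A)
  | success (s : Fin (d.n - d.k) → A) (bs : List A) (gi : Fin d.lam → List A)
      (g be : List A) (e out : Fin d.n → A)

/-- Apply a function to all elements recorded in a trace. -/
def Trace.map {d : Sizes} {A B : Type*} (φ : A → B) : Trace d A → Trace d B
  | .zeroSyndrome s out => .zeroSyndrome (φ ∘ s) (φ ∘ out)
  | .supportNotFree s => .supportNotFree (φ ∘ s)
  | .rankNotDivisible s bs => .rankNotDivisible (φ ∘ s) (bs.map φ)
  | .intersectionNotFree s bs gi g =>
      .intersectionNotFree (φ ∘ s) (bs.map φ) (fun i => (gi i).map φ) (g.map φ)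
  | .rankMismatch s bs gi g be =>
      .rankMismatch (φ ∘ s) (bs.map φ) (fun i => (gi i).map φ) (g.map φ) (be.map φ)
  | .noErasureSolution s bs gi g be =>
      .noErasureSolution (φ ∘ s) (bs.map φ) (fun i => (gi i).map φ) (g.map φ) (be.map φ)
  | .success s bs gi g be e out =>
      .success (φ ∘ s) (bs.map φ) (fun i => (gi i).map φ) (g.map φ) (be.map φ) (φ ∘ e) (φ ∘ out)

section Algorithm

variable (R : Type*) {S : Type*} [CommRing R] [CommRing S] [Algebra R S]

/-- The list `l` generates the `R`-module `N`. -/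
def ListSpans (l : List S) (N : Submodule R S) : Prop :=
  Submodule.span R {x | x ∈ l} = N

/-- The list `l` is a basis of the `R`-module `N`. -/
def ListIsBasis (l : List S) (N : Submodule R S) : Prop :=
  LinearIndependent R l.get ∧ ListSpans R l N

variable {d : Sizes}

/-- The shifted support `f⁻¹ 𝒮 = {f⁻¹ x : x ∈ 𝒮}`, where `𝒮` is the support of `s`. -/
noncomputable def shiftedSupport (f : S) (s : Fin (d.n - d.k) → S) : Submodule R S :=
  (vecSupport R s).map (LinearMap.mulLeft R (Ring.inverse f))

/-- The module `ℰ' = ⋂ i, fᵢ⁻¹ 𝒮`. -/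
noncomputable def errorModule (f : Fin d.lam → S) (s : Fin (d.n - d.k) → S) : Submodule R S :=
  ⨅ i, shiftedSupport R (f i) s

/-- `s` is the syndrome of `r`, is not zero, and its support is free with basis `bs`. -/
def PassedFreeTest (H : Matrix (Fin (d.n - d.k)) (Fin d.n) S) (r : Fin d.n → S)
    (s : Fin (d.n - d.k) → S) (bs : List S) : Prop :=
  s = H *ᵥ r ∧ s ≠ 0 ∧ Module.Free R (vecSupport R s) ∧ ListIsBasis R bs (vecSupport R s)

/-- In addition, `lam` divides the rank of the support, and `gi i` and `g` generate the shifted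
supports and their intersection. -/
def PassedDivisibilityTest (f : Fin d.lam → S) (H : Matrix (Fin (d.n - d.k)) (Fin d.n) S)
    (r : Fin d.n → S) (s : Fin (d.n - d.k) → S) (bs : List S) (gi : Fin d.lam → List S)
    (g : List S) : Prop :=
  PassedFreeTest R H r s bs ∧ d.lam ∣ freeRank R (vecSupport R s) ∧
    (∀ i, ListSpans R (gi i) (shiftedSupport R (f i) s)) ∧ ListSpans R g (errorModule R f s)

/-- In addition, the intersection `ℰ'` is free with basis `be`. -/
def PassedIntersectionTest (f : Fin d.lam → S) (H : Matrix (Fin (d.n - d.k)) (Fin d.n) S)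
    (r : Fin d.n → S) (s : Fin (d.n - d.k) → S) (bs : List S) (gi : Fin d.lam → List S)
    (g be : List S) : Prop :=
  PassedDivisibilityTest R f H r s bs gi g ∧ Module.Free R (errorModule R f s) ∧
    ListIsBasis R be (errorModule R f s)

/-- The condition `frk ℰ' = t'` and `frk (ℰ' ℱ) = ν`, where `ν = frk 𝒮` and `t' = ν / lam`. -/
def RanksMatch (F : Submodule R S) (f : Fin d.lam → S) (s : Fin (d.n - d.k) → S) : Prop :=
  freeRank R (errorModule R f s) = freeRank R (vecSupport R s) / d.lam ∧
    freeRank R ↥(errorModule R f s * F) = freeRank R (vecSupport R s)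

/-- `e` solves the erasure decoding problem with support `ℰ'` with respect to the syndrome `s`. -/
def IsErasureSolution (f : Fin d.lam → S) (H : Matrix (Fin (d.n - d.k)) (Fin d.n) S)
    (s : Fin (d.n - d.k) → S) (e : Fin d.n → S) : Prop :=
  vecSupport R e = errorModule R f s ∧ H *ᵥ e = s

/-- The trace records a run of the decoding algorithm over local rings on the parity-check matrix
`H`, the basis `f` of `F` and the received word `r`. -/
def IsDecoderRun (F : Submodule R S) (f : Fin d.lam → S)
    (H : Matrix (Fin (d.n - d.k)) (Fin d.n) S) (r : Fin d.n → S) : Trace d S → Prop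
  | .zeroSyndrome s out => s = H *ᵥ r ∧ s = 0 ∧ out = r
  | .supportNotFree s => s = H *ᵥ r ∧ s ≠ 0 ∧ ¬ Module.Free R (vecSupport R s)
  | .rankNotDivisible s bs =>
      PassedFreeTest R H r s bs ∧ ¬ d.lam ∣ freeRank R (vecSupport R s)
  | .intersectionNotFree s bs gi g =>
      PassedDivisibilityTest R f H r s bs gi g ∧ ¬ Module.Free R (errorModule R f s)
  | .rankMismatch s bs gi g be =>
      PassedIntersectionTest R f H r s bs gi g be ∧ ¬ RanksMatch R F f s
  | .noErasureSolution s bs gi g be =>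
      PassedIntersectionTest R f H r s bs gi g be ∧ RanksMatch R F f s ∧
        ¬ ∃ e, IsErasureSolution R f H s e
  | .success s bs gi g be e out =>
      PassedIntersectionTest R f H r s bs gi g be ∧ RanksMatch R F f s ∧
        IsErasureSolution R f H s e ∧ out = r - e

end Algorithm

/-! The cost model: computation trees over `R` -/

/-- The read-only input cells, each holding one element of `R`. An element of `S` is stored through
its `m` coordinates in the basis `1, θ, …, θ ^ (m - 1)` over `R`. -/
inductive InputCell (d : Sizes)
  /-- the coordinates of `θ ^ m`, which determine the multiplication of `S` -/
  | modulus (c : Fin d.m)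
  /-- the entries of the parity-check matrix -/
  | parity (i : Fin (d.n - d.k)) (j : Fin d.n) (c : Fin d.m)
  /-- the basis elements `f l` of `F` -/
  | basis (l : Fin d.lam) (c : Fin d.m)
  /-- the precomputed inverses of the `f l` -/
  | basisInv (l : Fin d.lam) (c : Fin d.m)
  /-- the received word -/
  | received (j : Fin d.n) (c : Fin d.m)
  /-- the generators `z a` of `R` as a module over `R₀` -/
  | generator (a : Fin d.gam)

/-- The input cells, and work cells numbered by `ℕ`. -/
abbrev Cell (d : Sizes) := InputCell d ⊕ ℕ

/-- The operations in `R`. -/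
inductive Instr (d : Sizes)
  | one
  | add (x y : Cell d)
  | sub (x y : Cell d)
  | mul (x y : Cell d)
  /-- inverse of a unit; the result is `0` for a non-unit -/
  | inv (x : Cell d)
  /-- a quotient in the subring `R₀` -/
  | quot (x y : Cell d)
  /-- a generator of the annihilator in the subring `R₀` -/
  | ann (x : Cell d)
  /-- the `i`-th coordinate over the subring `R₀` -/
  | coord (i : Fin d.gam) (x : Cell d)

/-- A computation tree with leaves in `α`. It depends on the sizes only; the elements of `R` enter
through the operations and the tests for zero. -/
inductive Prog (d : Sizes) (α : Type)
  | halt (out : α)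
  | exec (dst : ℕ) (I : Instr d) (next : Prog d α)
  | ifZero (x : Cell d) (yes no : Prog d α)

section Semantics

variable {R : Type*} [CommRing R] (R₀ : Subring R)

open Classical in
/-- A quotient of `x` by `y` in `R₀`, if `x` and `y` are in `R₀` and `y` divides `x` there, and `0`
otherwise. -/
noncomputable def galoisQuot (x y : R) : R :=
  if h : y ∈ R₀ ∧ ∃ c ∈ R₀, y * c = x then h.2.choose else 0

open Classical in
/-- A generator of the ideal `{c ∈ R₀ | c * x = 0}` of `R₀`, which is a principal ideal ring when it
is a Galois ring. -/
noncomputable def galoisAnn (x : R) : R :=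
  if h : ∃ g ∈ R₀, ∀ c ∈ R₀, c * x = 0 ↔ ∃ a ∈ R₀, c = a * g then h.choose else 0

open Classical in
/-- Coefficients in `R₀` that express `x` through the generators `z`. -/
noncomputable def galoisCoord {γ : ℕ} (z : Fin γ → R) (x : R) (i : Fin γ) : R :=
  if h : ∃ c : Fin γ → R₀, x = ∑ a, (c a : R) * z a then (h.choose i : R) else 0

variable {d : Sizes} (z : Fin d.gam → R)

/-- The value of an operation in a given memory state. -/
noncomputable def Instr.eval (mem : Cell d → R) : Instr d → R
  | .one => 1
  | .add x y => mem x + mem y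
  | .sub x y => mem x - mem y
  | .mul x y => mem x * mem y
  | .inv x => Ring.inverse (mem x)
  | .quot x y => galoisQuot R₀ (mem x) (mem y)
  | .ann x => galoisAnn R₀ (mem x)
  | .coord i x => galoisCoord R₀ z (mem x) i

/-- Overwrite one work cell. -/
def writeCell (mem : Cell d → R) (dst : ℕ) (v : R) : Cell d → R :=
  Sum.elim (fun i => mem (Sum.inl i)) (fun w => if w = dst then v else mem (Sum.inr w))

open Classical in
/-- Run a tree: the leaf reached, the final memory, and the number of operations and tests
performed. -/
noncomputable def Prog.run {α : Type} : Prog d α → (Cell d → R) → α × (Cell d → R) × ℕ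
  | .halt out, mem => (out, mem, 0)
  | .exec dst I next, mem =>
      let res := next.run (writeCell mem dst (I.eval R₀ z mem))
      (res.1, res.2.1, res.2.2 + 1)
  | .ifZero x yes no, mem =>
      let res := if mem x = 0 then yes.run mem else no.run mem
      (res.1, res.2.1, res.2.2 + 1)

end Semantics

/-- The memory at the start: the input cells hold the input, in coordinates with respect to the
basis `b = (1, θ, …, θ ^ (m - 1))`, and the work cells hold `0`. -/
noncomputable def initialMemory {R S : Type*} [CommRing R] [CommRing S] [Algebra R S] {d : Sizes}
    (θ : S) (b : Module.Basis (Fin d.m) R S) (H : Matrix (Fin (d.n - d.k)) (Fin d.n) S)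
    (f : Fin d.lam → S) (r : Fin d.n → S) (z : Fin d.gam → R) : Cell d → R
  | .inl (.modulus c) => b.repr (θ ^ d.m) c
  | .inl (.parity i j c) => b.repr (H i j) c
  | .inl (.basis l c) => b.repr (f l) c
  | .inl (.basisInv l c) => b.repr (Ring.inverse (f l)) c
  | .inl (.received j c) => b.repr (r j) c
  | .inl (.generator a) => z a
  | .inr _ => 0

/-- The element of `S` whose coordinates are stored in the given cells. -/
noncomputable def readElement {R S : Type*} [CommRing R] [CommRing S] [Algebra R S] {d : Sizes}
    (b : Module.Basis (Fin d.m) R S) (mem : Cell d → R) (v : Fin d.m → Cell d) : S :=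
  ∑ c, mem (v c) • b c

/-!
The computation tree writes every result to a fresh work cell. Cells are then never overwritten, a
cell denotes one ring element once and for all, and a program can be specified by a bound on its
cost and a postcondition that survives whatever is executed later (`Ensures`). What remains is to
carry out the steps of the decoder within the bound by linear algebra over finite local rings, which
rests on three ideas.

*Freeness and free rank.* Gaussian elimination that pivots on units only (`Ensures.echelon`) splits
the span `N` of a list of vectors into a free module `B`, generated by the pivot vectors, and
remainders with all coordinates in the maximal ideal `𝔪`. A nonzero element `a` of `R` with
`a 𝔪 = 0` kills the remainders, so that `a N = a B`; counting these finite modules shows that the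
number of pivots is the free rank of `N` (`freeRank_eq_of_smul`) and that `N` is free exactly when
all remainders vanish (`free_iff_of_smul`).

*Linear systems.* Over `R` itself kernels cannot be found by elimination, as `R` need not be a
principal ideal ring. Over the Galois ring `R₀` they can: divisibility is a total relation on `R₀`,
since every element that is not a multiple of `p` is a unit (`IsMaximalGaloisSubring.dvd_total`).
As `R` is a sum of `γ` cyclic `R₀`-modules, an equation over `R` in `b` unknowns amounts to `γ`
conditions, each with values in a cyclic `R₀`-module, on `bγ` generators over `R₀`. A condition is
imposed on a list of generators by picking one whose value divides all the others, clearing the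
others with it, and multiplying it by a generator of the annihilator of its value
(`Ensures.restrict`). A system of `l` equations thus costs `O(l b² γ²)` operations
(`Ensures.kernel`). An inhomogeneous system is solvable if and only if one of the generators of the
kernel of its augmented matrix has a unit as its last coordinate (`Ensures.solve`).

*The error module and the erasure problem.* The `fᵢ` are units, because a nonunit of `S` is killed
by `a`. Hence `ℰ' = {x | ∀ i, fᵢ x ∈ 𝒮}`, and reducing `fᵢ x` modulo the echelon basis of the
support `𝒮` turns this into the kernel of one matrix with `λ m` rows and `m` columns
(`mem_errorModule`). When the ranks match, the `ν` products of a basis of `ℰ'` with the `fₗ` are a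
basis of `𝒮` (`products_basis`). In terms of the coordinates of an error `e` in the basis of `ℰ'`,
the equation `H e = s` then splits into `t'` systems over `R`, one for each basis element of `ℰ'`
(`mulVec_eq_iff`), and every solution automatically has full support `ℰ'`
(`span_range_eq_of_mulVec_eq`).

Since `λ ≤ m`, `γ ≥ 1` and `mn ≤ max (n²) (m²)`, every step is within the asserted bound, and the
constants add up (`decoder_cost_le`).
-/

/-! ### Computations on write-once memory -/

/-- Substitute trees for the leaves of a tree. -/
def Prog.bind {d : Sizes} {α β : Type} : Prog d α → (α → Prog d β) → Prog d β
  | .halt a, f => f a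
  | .exec dst I next, f => .exec dst I (next.bind f)
  | .ifZero x yes no, f => .ifZero x (yes.bind f) (no.bind f)

/-- A tree parametrised by the number of the first unused work cell; a leaf returns this number
along with its result. Since every operation writes to a fresh cell, no value is ever overwritten,
and a cell stands for its value once and for all. -/
def Comp (d : Sizes) (α : Type) : Type := ℕ → Prog d (α × ℕ)

namespace Comp

variable {d : Sizes} {α β : Type}

instance : Monad (Comp d) where
  pure a := fun k => .halt (a, k)
  bind c f := fun k => (c k).bind fun p => f p.1 p.2

/-- Perform an operation; the result is the fresh cell that holds its value. -/
def op (I : Instr d) : Comp d (Cell d) := fun k => .exec k I (.halt (.inr k, k + 1))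

/-- Branch on whether a cell holds zero. -/
def ifZ (x : Cell d) (c₁ c₂ : Comp d α) : Comp d α := fun k => .ifZero x (c₁ k) (c₂ k)

end Comp

/-- The contents of the memory and the number of the first unused work cell. -/
structure MemState (d : Sizes) (R : Type*) where
  mem : Cell d → R
  fresh : ℕ

/-- A cell is in use if it is an input cell or a work cell below the first unused one. -/
def InUse {d : Sizes} (k : ℕ) : Cell d → Prop
  | .inl _ => True
  | .inr w => w < k

section Semantics

variable {R : Type*} {d : Sizes}

/-- `σ ≤ τ` if `τ` arises from `σ` by writing to unused cells. -/
instance : Preorder (MemState d R) where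
  le σ τ := σ.fresh ≤ τ.fresh ∧ ∀ x, InUse σ.fresh x → τ.mem x = σ.mem x
  le_refl _ := ⟨le_rfl, fun _ _ => rfl⟩
  le_trans σ τ ρ h₁ h₂ := ⟨h₁.1.trans h₂.1, fun x hx => by
    rw [h₂.2 x ?_, h₁.2 x hx]
    cases x with
    | inl _ => trivial
    | inr w => exact lt_of_lt_of_le (show w < σ.fresh from hx) h₁.1⟩

/-- The cell `x` is in use and holds the value `v`. -/
def Holds (σ : MemState d R) (x : Cell d) (v : R) : Prop := InUse σ.fresh x ∧ σ.mem x = v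

/-- The cells `x i` are in use and hold the values `v i`. -/
def Stores {ι : Type*} (σ : MemState d R) (x : ι → Cell d) (v : ι → R) : Prop :=
  ∀ i, Holds σ (x i) (v i)

/-- The list `l` of vectors of cells holds the list `vs` of vectors. -/
def StoresList {ι : Type*} (σ : MemState d R) (l : List (ι → Cell d)) (vs : List (ι → R)) : Prop :=
  List.Forall₂ (Stores σ) l vs

variable {σ τ : MemState d R}

lemma Holds.mono {x : Cell d} {v : R} (h : Holds σ x v) (hl : σ ≤ τ) : Holds τ x v := by
  refine ⟨?_, (hl.2 x h.1).trans h.2⟩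
  cases x with
  | inl _ => trivial
  | inr w => exact lt_of_lt_of_le (show w < σ.fresh from h.1) hl.1

lemma Stores.mono {ι : Type*} {x : ι → Cell d} {v : ι → R} (h : Stores σ x v) (hl : σ ≤ τ) :
    Stores τ x v := fun i => (h i).mono hl

lemma StoresList.mono {ι : Type*} {l : List (ι → Cell d)} {vs : List (ι → R)}
    (h : StoresList σ l vs) (hl : σ ≤ τ) : StoresList τ l vs :=
  List.Forall₂.imp (fun _ _ h => h.mono hl) h

variable [CommRing R] (R₀ : Subring R) (z : Fin d.gam → R) {α β : Type}

/-- Started in the state `σ`, the computation `c` takes at most `N` operations and tests, leaves the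
cells in use unchanged, and its result and the final state satisfy `Q`. -/
def Ensures (c : Comp d α) (σ : MemState d R) (N : ℕ) (Q : α → MemState d R → Prop) : Prop :=
  σ ≤ ⟨((c σ.fresh).run R₀ z σ.mem).2.1, ((c σ.fresh).run R₀ z σ.mem).1.2⟩ ∧
  ((c σ.fresh).run R₀ z σ.mem).2.2 ≤ N ∧
  Q ((c σ.fresh).run R₀ z σ.mem).1.1
    ⟨((c σ.fresh).run R₀ z σ.mem).2.1, ((c σ.fresh).run R₀ z σ.mem).1.2⟩

variable {R₀ z}

lemma Prog.run_bind (p : Prog d α) (f : α → Prog d β) (mem : Cell d → R) :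
    (p.bind f).run R₀ z mem =
      (((f (p.run R₀ z mem).1).run R₀ z (p.run R₀ z mem).2.1).1,
        ((f (p.run R₀ z mem).1).run R₀ z (p.run R₀ z mem).2.1).2.1,
        ((f (p.run R₀ z mem).1).run R₀ z (p.run R₀ z mem).2.1).2.2 + (p.run R₀ z mem).2.2) := by
  induction p generalizing mem with
  | halt a => simp [Prog.bind, Prog.run]
  | exec dst I next ih => simp [Prog.bind, Prog.run, ih, add_assoc]
  | ifZero x yes no ih₁ ih₂ =>
    by_cases h : mem x = 0 <;> simp [Prog.bind, Prog.run, ih₁, ih₂, h, add_assoc]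

namespace Ensures

lemma pure {a : α} {N : ℕ} {Q : α → MemState d R → Prop} (h : Q a σ) :
    Ensures R₀ z (Pure.pure a : Comp d α) σ N Q :=
  ⟨le_rfl, Nat.zero_le _, h⟩

lemma bind {c : Comp d α} {f : α → Comp d β} {N N' : ℕ} {Q : α → MemState d R → Prop}
    {Q' : β → MemState d R → Prop} (h : Ensures R₀ z c σ N Q)
    (h' : ∀ a τ, σ ≤ τ → Q a τ → Ensures R₀ z (f a) τ N' Q') :
    Ensures R₀ z (c >>= f) σ (N + N') Q' := by
  obtain ⟨h₁, h₂, h₃⟩ := h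
  obtain ⟨h₁', h₂', h₃'⟩ := h' _ _ h₁ h₃
  have key : (c >>= f) σ.fresh = (c σ.fresh).bind fun p => f p.1 p.2 := rfl
  unfold Ensures
  rw [key, Prog.run_bind]
  exact ⟨h₁.trans h₁', by dsimp only at *; omega, h₃'⟩

lemma weaken {c : Comp d α} {N N' : ℕ} {Q Q' : α → MemState d R → Prop}
    (h : Ensures R₀ z c σ N Q) (hN : N ≤ N') (hQ : ∀ a τ, σ ≤ τ → Q a τ → Q' a τ) :
    Ensures R₀ z c σ N' Q' :=
  ⟨h.1, h.2.1.trans hN, hQ _ _ h.1 h.2.2⟩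

lemma weakenCost {c : Comp d α} {N N' : ℕ} {Q : α → MemState d R → Prop}
    (h : Ensures R₀ z c σ N Q) (hN : N ≤ N') : Ensures R₀ z c σ N' Q :=
  h.weaken hN fun _ _ _ h => h

lemma ifZ {x : Cell d} {v : R} (hx : Holds σ x v) {c₁ c₂ : Comp d α} {N : ℕ}
    {Q : α → MemState d R → Prop} (h₁ : v = 0 → Ensures R₀ z c₁ σ N Q)
    (h₂ : v ≠ 0 → Ensures R₀ z c₂ σ N Q) :
    Ensures R₀ z (Comp.ifZ x c₁ c₂) σ (1 + N) Q := by
  unfold Ensures Comp.ifZ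
  by_cases h : v = 0
  · obtain ⟨h₁, h₂, h₃⟩ := h₁ h
    simp only [Prog.run, hx.2, h, if_true]
    exact ⟨h₁, by omega, h₃⟩
  · obtain ⟨h₁, h₂, h₃⟩ := h₂ h
    simp only [Prog.run, hx.2, h, if_false]
    exact ⟨h₁, by omega, h₃⟩

lemma op {I : Instr d} {v : R} (hv : I.eval R₀ z σ.mem = v) :
    Ensures R₀ z (Comp.op I) σ 1 fun a τ => Holds τ a v := by
  unfold Ensures Comp.op
  simp only [Prog.run]
  refine ⟨⟨Nat.le_succ _, ?_⟩, le_rfl, Nat.lt_succ_self σ.fresh, ?_⟩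
  · rintro (i | w) hx
    · rfl
    · have : w ≠ σ.fresh := (show w < σ.fresh from hx).ne
      simp [writeCell, this]
  · simp [writeCell, hv]

variable {x y : Cell d} {v w : R}

lemma one : Ensures R₀ z (Comp.op .one) σ 1 fun a τ => Holds τ a 1 := op rfl

lemma add (hx : Holds σ x v) (hy : Holds σ y w) :
    Ensures R₀ z (Comp.op (.add x y)) σ 1 fun a τ => Holds τ a (v + w) :=
  op (by rw [Instr.eval, hx.2, hy.2])

lemma sub (hx : Holds σ x v) (hy : Holds σ y w) :
    Ensures R₀ z (Comp.op (.sub x y)) σ 1 fun a τ => Holds τ a (v - w) :=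
  op (by rw [Instr.eval, hx.2, hy.2])

lemma mul (hx : Holds σ x v) (hy : Holds σ y w) :
    Ensures R₀ z (Comp.op (.mul x y)) σ 1 fun a τ => Holds τ a (v * w) :=
  op (by rw [Instr.eval, hx.2, hy.2])

lemma inv (hx : Holds σ x v) :
    Ensures R₀ z (Comp.op (.inv x)) σ 1 fun a τ => Holds τ a (Ring.inverse v) :=
  op (by rw [Instr.eval, hx.2])

lemma quot (hx : Holds σ x v) (hy : Holds σ y w) :
    Ensures R₀ z (Comp.op (.quot x y)) σ 1 fun a τ => Holds τ a (galoisQuot R₀ v w) :=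
  op (by rw [Instr.eval, hx.2, hy.2])

lemma ann (hx : Holds σ x v) :
    Ensures R₀ z (Comp.op (.ann x)) σ 1 fun a τ => Holds τ a (galoisAnn R₀ v) :=
  op (by rw [Instr.eval, hx.2])

lemma coord (i : Fin d.gam) (hx : Holds σ x v) :
    Ensures R₀ z (Comp.op (.coord i x)) σ 1 fun a τ => Holds τ a (galoisCoord R₀ z v i) :=
  op (by rw [Instr.eval, hx.2])

end Ensures

end Semantics

namespace Comp

variable {d : Sizes} {α : Type}

/-- The constant zero. -/
def zero : Comp d (Cell d) := do
  let x ← op .one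
  op (.sub x x)

/-- Perform the computations `f 0, …, f (n - 1)` one after the other. -/
def vec : {n : ℕ} → (Fin n → Comp d α) → Comp d (Fin n → α)
  | 0, _ => pure Fin.elim0
  | _ + 1, f => do
    let a ← f 0
    let as ← vec fun i => f i.succ
    pure (Fin.cons a as)

/-- The sum of a vector. -/
def sum : {n : ℕ} → (Fin n → Cell d) → Comp d (Cell d)
  | 0, _ => zero
  | _ + 1, x => do
    let s ← sum fun i => x i.succ
    op (.add (x 0) s)

/-- The dot product of two vectors. -/
def dot {n : ℕ} (x y : Fin n → Cell d) : Comp d (Cell d) := do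
  let p ← vec fun i => op (.mul (x i) (y i))
  sum p

/-- The vector `q • x`. -/
def smul {n : ℕ} (q : Cell d) (x : Fin n → Cell d) : Comp d (Fin n → Cell d) :=
  vec fun i => op (.mul q (x i))

/-- The vector `x - q • y`. -/
def subSmul {n : ℕ} (x : Fin n → Cell d) (q : Cell d) (y : Fin n → Cell d) :
    Comp d (Fin n → Cell d) :=
  vec fun i => do
    let p ← op (.mul q (y i))
    op (.sub (x i) p)

/-- Test whether all tests `f i` succeed. -/
def all {n : ℕ} (f : Fin n → Comp d Bool) : Comp d Bool := do
  let t ← vec f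
  pure (decide (∀ i, t i = true))

/-- Test whether a vector is zero. -/
def isZero {n : ℕ} (x : Fin n → Cell d) : Comp d Bool :=
  all fun i => ifZ (x i) (pure true) (pure false)

/-- Find a unit among the entries of a vector, together with its inverse. -/
def findUnit {n : ℕ} (x : Fin n → Cell d) : Comp d (Option (Fin n × Cell d)) := do
  let t ← vec fun i => do
    let c ← op (.inv (x i))
    ifZ c (pure none) (pure (some (i, c)))
  pure ((List.ofFn t).findSome? id)

end Comp

section

variable {R : Type*} {d : Sizes} [CommRing R] {R₀ : Subring R} {z : Fin d.gam → R} {α : Type}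
  {σ : MemState d R}

namespace Ensures

lemma zero : Ensures R₀ z Comp.zero σ 2 fun a τ => Holds τ a 0 :=
  bind one fun _ _ _ h => (sub h h).weaken le_rfl fun _ _ _ h => by simpa using h

lemma vec {n N : ℕ} {f : Fin n → Comp d α} {Q : Fin n → α → MemState d R → Prop}
    (hQ : ∀ i a τ ρ, τ ≤ ρ → Q i a τ → Q i a ρ)
    (h : ∀ i τ, σ ≤ τ → Ensures R₀ z (f i) τ N (Q i)) :
    Ensures R₀ z (Comp.vec f) σ (n * N) fun a τ => ∀ i, Q i (a i) τ := by
  induction n generalizing σ with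
  | zero => exact pure fun i => i.elim0
  | succ n ih =>
    refine weakenCost (bind (h 0 σ le_rfl) fun a τ hτ ha => bind
      (ih (Q := fun i => Q i.succ) (fun i => hQ _) fun i ρ hρ => h _ _ (hτ.trans hρ))
      fun as ρ hρ has => pure (N := 0) ?_) (by rw [Nat.succ_mul]; omega)
    intro i
    cases i using Fin.cases with
    | zero => exact hQ _ _ _ _ hρ ha
    | succ i => exact has i

/-- The special case of `Ensures.vec` in which each computation returns a cell. -/
lemma vecCells {n N : ℕ} {f : Fin n → Comp d (Cell d)} {v : Fin n → R}
    (h : ∀ i τ, σ ≤ τ → Ensures R₀ z (f i) τ N fun a ρ => Holds ρ a (v i)) :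
    Ensures R₀ z (Comp.vec f) σ (n * N) fun a τ => Stores τ a v :=
  vec (Q := fun i a τ => Holds τ a (v i)) (fun _ _ _ _ hl h => h.mono hl) h

/-- The special case of `Ensures.vec` in which each computation returns a vector of cells. -/
lemma vecStores {n N k : ℕ} {f : Fin n → Comp d (Fin k → Cell d)} {v : Fin n → Fin k → R}
    (h : ∀ i τ, σ ≤ τ → Ensures R₀ z (f i) τ N fun a ρ => Stores ρ a (v i)) :
    Ensures R₀ z (Comp.vec f) σ (n * N) fun a τ => ∀ i, Stores τ (a i) (v i) :=
  vec (Q := fun i a τ => Stores τ a (v i)) (fun _ _ _ _ hl h => h.mono hl) h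

variable {n : ℕ} {x y : Fin n → Cell d} {v w : Fin n → R}

lemma sum (hx : Stores σ x v) :
    Ensures R₀ z (Comp.sum x) σ (n + 2) fun a τ => Holds τ a (∑ i, v i) := by
  induction n with
  | zero => exact zero.weaken (by omega) fun _ _ _ h => by simpa using h
  | succ n ih =>
    refine weakenCost (bind (ih (v := fun i => v i.succ) fun i => hx i.succ) fun a τ hτ ha =>
      (add ((hx 0).mono hτ) ha).weaken le_rfl fun _ _ _ h => ?_) (by omega)
    rwa [Fin.sum_univ_succ]

lemma dot (hx : Stores σ x v) (hy : Stores σ y w) :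
    Ensures R₀ z (Comp.dot x y) σ (2 * n + 2) fun a τ => Holds τ a (v ⬝ᵥ w) :=
  weakenCost (bind (vecCells (v := fun i => v i * w i) fun i _ hτ =>
    mul ((hx i).mono hτ) ((hy i).mono hτ)) fun _ _ _ h => sum h) (by omega)

lemma smul {q : Cell d} {c : R} (hq : Holds σ q c) (hx : Stores σ x v) :
    Ensures R₀ z (Comp.smul q x) σ n fun a τ => Stores τ a (c • v) :=
  weakenCost (vecCells (v := c • v) fun i _ hτ => mul (hq.mono hτ) ((hx i).mono hτ)) (by omega)

lemma subSmul {q : Cell d} {c : R} (hx : Stores σ x v) (hq : Holds σ q c) (hy : Stores σ y w) :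
    Ensures R₀ z (Comp.subSmul x q y) σ (2 * n) fun a τ => Stores τ a (v - c • w) :=
  weakenCost (vecCells (v := v - c • w) fun i _ hτ =>
    bind (mul (hq.mono hτ) ((hy i).mono hτ)) fun _ _ hρ h =>
      sub ((hx i).mono (hτ.trans hρ)) h) (by omega)

lemma all {N : ℕ} {f : Fin n → Comp d Bool} {P : Fin n → Prop}
    (h : ∀ i τ, σ ≤ τ → Ensures R₀ z (f i) τ N fun t _ => t = true ↔ P i) :
    Ensures R₀ z (Comp.all f) σ (n * N) fun t _ => t = true ↔ ∀ i, P i :=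
  weakenCost (bind (vec (Q := fun i t _ => t = true ↔ P i) (fun _ _ _ _ _ h => h) h)
    fun t _ _ ht => pure (N := 0) (by simp [ht])) le_rfl

lemma isZero (hx : Stores σ x v) :
    Ensures R₀ z (Comp.isZero x) σ n fun t _ => t = true ↔ v = 0 :=
  (all (N := 1) (P := fun i => v i = 0) fun i _ hτ =>
    ifZ (N := 0) ((hx i).mono hτ) (fun h => pure (by simp [h])) fun h => pure (by simp [h])).weaken
      (by omega) fun _ _ _ h => by rw [h, funext_iff]; rfl

lemma findUnit [Nontrivial R] (hx : Stores σ x v) :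
    Ensures R₀ z (Comp.findUnit x) σ (n * 2) fun t τ => match t with
      | none => ∀ i, ¬ IsUnit (v i)
      | some (i, c) => IsUnit (v i) ∧ Holds τ c (Ring.inverse (v i)) := by
  refine weakenCost (bind (vec (N := 2) (Q := fun i t τ => match t with
      | none => ¬ IsUnit (v i)
      | some (j, c) => j = i ∧ IsUnit (v i) ∧ Holds τ c (Ring.inverse (v i))) ?_ ?_)
      (N' := 0) ?_) (by omega)
  · rintro i (_ | ⟨j, c⟩) τ ρ hl h
    · exact h
    · exact ⟨h.1, h.2.1, h.2.2.mono hl⟩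
  · intro i τ hτ
    refine bind (inv ((hx i).mono hτ)) fun a ρ hρ ha => ifZ (N := 0) ha (fun h => pure ?_)
      fun h => pure ⟨rfl, ?_, ha⟩
    · exact Ring.not_isUnit_iff_inverse_eq_zero.2 h
    · exact Ring.isUnit_iff_inverse_ne_zero.2 h
  · intro t τ _ ht
    refine pure ?_
    cases h : (List.ofFn t).findSome? id with
    | none =>
      intro i
      have hi := ht i
      rw [show t i = none from List.findSome?_eq_none_iff.1 h (t i) (by simp)] at hi
      exact hi
    | some p =>
      obtain ⟨j, c⟩ := p
      obtain ⟨o, ho, hp⟩ := List.exists_of_findSome?_eq_some h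
      obtain ⟨i, rfl⟩ := (List.mem_ofFn' _ _).1 ho
      have hi := ht i
      rw [show t i = some (j, c) from hp] at hi
      obtain ⟨rfl, h1, h2⟩ := hi
      exact ⟨h1, h2⟩

end Ensures

end

/-! ### Arithmetic in the extension ring -/

namespace Comp

variable {d : Sizes} {n k : ℕ}

/-- The linear combination `∑ j, q j • w j`. -/
def linComb (q : Fin n → Cell d) (w : Fin n → Fin k → Cell d) : Comp d (Fin k → Cell d) :=
  vec fun i => dot q fun j => w j i

/-- The product `x θ`, where `t` holds the coordinates of `θ ^ n`. -/
def mulTheta (t x : Fin n → Cell d) : Comp d (Fin n → Cell d) :=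
  vec fun i => do
    let p ← op (.mul (x ⟨n - 1, by have := i.2; omega⟩) (t i))
    if i.1 = 0 then pure p else op (.add (x ⟨i.1 - 1, by have := i.2; omega⟩) p)

/-- The products `x, x θ, …, x θ ^ (k - 1)`. -/
def shifts (t : Fin n → Cell d) : (k : ℕ) → (Fin n → Cell d) → Comp d (Fin k → Fin n → Cell d)
  | 0, _ => pure Fin.elim0
  | k + 1, x => do
    let y ← mulTheta t x
    let ys ← shifts t k y
    pure (Fin.cons x ys)

/-- The product `x y`. -/
def mulElt (t x y : Fin n → Cell d) : Comp d (Fin n → Cell d) := do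
  let xs ← shifts t n x
  linComb y xs

/-- The sum `∑ j, x j * y j` of products. -/
def dotElt (t : Fin n → Cell d) (x y : Fin k → Fin n → Cell d) : Comp d (Fin n → Cell d) := do
  let p ← vec fun j => mulElt t (x j) (y j)
  vec fun c => sum fun j => p j c

end Comp

section

variable {R S : Type*} {d : Sizes} [CommRing R] [CommRing S] [Algebra R S] {R₀ : Subring R}
  {z : Fin d.gam → R} {σ : MemState d R} {n k : ℕ}

lemma Ensures.linComb {q : Fin n → Cell d} {w : Fin n → Fin k → Cell d} {c : Fin n → R}
    {v : Fin n → Fin k → R} (hq : Stores σ q c) (hw : ∀ j, Stores σ (w j) (v j)) :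
    Ensures R₀ z (Comp.linComb q w) σ (k * (2 * n + 2)) fun a τ => Stores τ a (∑ j, c j • v j) :=
  (vecCells (v := fun i => c ⬝ᵥ fun j => v j i) fun i _ hτ =>
    dot (hq.mono hτ) fun j => (hw j i).mono hτ).weaken le_rfl fun a τ _ h i => by
      simpa [dotProduct, Finset.sum_apply] using h i

variable {θ : S} {b : Module.Basis (Fin n) R S}

lemma equivFun_mul_theta (hb : ∀ i, b i = θ ^ (i : ℕ)) (s : S) (i : Fin n) :
    b.equivFun (s * θ) i = (if i.1 = 0 then 0 else
      b.equivFun s ⟨i.1 - 1, by have := i.2; omega⟩) +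
      b.equivFun s ⟨n - 1, by have := i.2; omega⟩ * b.equivFun (θ ^ n) i := by
  cases n with
  | zero => exact i.elim0
  | succ n =>
    have h1 : s * θ = ∑ j : Fin n, b.equivFun s j.castSucc • b j.succ +
        b.equivFun s (Fin.last n) • θ ^ (n + 1) := by
      conv_lhs => rw [← b.sum_equivFun s, Finset.sum_mul, Fin.sum_univ_castSucc]
      simp [hb, pow_succ]
    conv_lhs => rw [h1]
    simp only [map_add, map_sum, map_smul, Pi.add_apply, Finset.sum_apply, Pi.smul_apply,
      smul_eq_mul, Module.Basis.equivFun_self]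
    congr 1
    cases i using Fin.cases with
    | zero => simp [Fin.succ_ne_zero]
    | succ i =>
      simp only [Fin.succ_inj, Fin.val_succ, Nat.add_eq_zero_iff, one_ne_zero, and_false, if_false]
      simp
      rfl

namespace Ensures

variable {t x y : Fin n → Cell d} {s u : S}

lemma mulTheta (hb : ∀ i, b i = θ ^ (i : ℕ)) (ht : Stores σ t (b.equivFun (θ ^ n)))
    (hx : Stores σ x (b.equivFun s)) :
    Ensures R₀ z (Comp.mulTheta t x) σ (2 * n) fun a τ => Stores τ a (b.equivFun (s * θ)) := by
  refine weakenCost (vecCells (N := 2) fun i τ hτ => bind (N' := 1)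
    (mul ((hx _).mono hτ) ((ht i).mono hτ)) fun a ρ hρ ha => ?_) (by omega)
  rw [equivFun_mul_theta hb]
  by_cases h : i.1 = 0
  · simp only [h, if_true, zero_add]
    exact pure ha
  · simp only [h, if_false]
    exact add ((hx _).mono (hτ.trans hρ)) ha

lemma shifts (hb : ∀ i, b i = θ ^ (i : ℕ)) (ht : Stores σ t (b.equivFun (θ ^ n)))
    (hx : Stores σ x (b.equivFun s)) :
    Ensures R₀ z (Comp.shifts t k x) σ (k * (2 * n))
      fun a τ => ∀ i, Stores τ (a i) (b.equivFun (s * θ ^ (i : ℕ))) := by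
  induction k generalizing σ x s with
  | zero => exact pure fun i => i.elim0
  | succ k ih =>
    refine weakenCost (bind (mulTheta hb ht hx) fun y τ hτ hy => bind (ih (ht.mono hτ) hy)
      fun ys ρ hρ hys => pure (N := 0) ?_) (by rw [Nat.succ_mul k]; omega)
    intro i
    cases i using Fin.cases with
    | zero => simpa using hx.mono (hτ.trans hρ)
    | succ i =>
      have := hys i
      rwa [mul_assoc, ← pow_succ'] at this

lemma mulElt (hb : ∀ i, b i = θ ^ (i : ℕ)) (ht : Stores σ t (b.equivFun (θ ^ n)))
    (hx : Stores σ x (b.equivFun s)) (hy : Stores σ y (b.equivFun u)) :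
    Ensures R₀ z (Comp.mulElt t x y) σ (6 * n ^ 2)
      fun a τ => Stores τ a (b.equivFun (s * u)) := by
  refine (bind (shifts hb ht hx) fun xs τ hτ hxs => linComb (hy.mono hτ) hxs).weaken ?_
    fun a τ _ h => ?_
  · rcases Nat.eq_zero_or_pos n with rfl | h
    · simp
    · nlinarith
  · convert h
    conv_lhs => rw [← b.sum_equivFun u, Finset.mul_sum]
    simp [hb]

lemma dotElt (hb : ∀ i, b i = θ ^ (i : ℕ)) (ht : Stores σ t (b.equivFun (θ ^ n)))
    {x y : Fin k → Fin n → Cell d} {s u : Fin k → S} (hx : ∀ j, Stores σ (x j) (b.equivFun (s j)))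
    (hy : ∀ j, Stores σ (y j) (b.equivFun (u j))) :
    Ensures R₀ z (Comp.dotElt t x y) σ (k * (6 * n ^ 2) + n * (k + 2))
      fun a τ => Stores τ a (b.equivFun (∑ j, s j * u j)) := by
  refine (bind (vecStores fun j _ hτ => mulElt hb (ht.mono hτ) ((hx j).mono hτ) ((hy j).mono hτ))
    fun p τ _ hp => vecCells (v := b.equivFun (∑ j, s j * u j)) fun c ρ hρ =>
      (sum fun j => (hp j c).mono hρ).weaken le_rfl fun _ _ _ h => ?_).weakenCost le_rfl
  simpa [Finset.sum_apply] using h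

end Ensures

end

/-! ### Free rank over a finite local ring -/

lemma exists_free_submodule_of_equiv {A M N : Type*} [CommRing A] [AddCommGroup M] [Module A M]
    [AddCommGroup N] [Module A N] (e : M ≃ₗ[A] N) (r : ℕ)
    (h : ∃ L : Submodule A M, Module.Free A L ∧ Module.finrank A L = r) :
    ∃ L : Submodule A N, Module.Free A L ∧ Module.finrank A L = r := by
  obtain ⟨L, h₁, h₂⟩ := h
  exact ⟨L.map e.toLinearMap, Module.Free.of_equiv (e.submoduleMap L),
    (e.submoduleMap L).finrank_eq ▸ h₂⟩

lemma freeRank_congr {A M N : Type*} [CommRing A] [AddCommGroup M] [Module A M] [AddCommGroup N]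
    [Module A N] (e : M ≃ₗ[A] N) : freeRank A M = freeRank A N := by
  unfold freeRank
  congr 1
  ext r
  exact ⟨exists_free_submodule_of_equiv e r, exists_free_submodule_of_equiv e.symm r⟩

/-- The annihilator of the maximal ideal of a finite local ring is not zero. -/
lemma exists_ne_zero_mul_maximalIdeal (R : Type*) [CommRing R] [Finite R] [IsLocalRing R] :
    ∃ s : R, s ≠ 0 ∧ ∀ a ∈ IsLocalRing.maximalIdeal R, s * a = 0 := by
  classical
  have hnil : ∃ k, IsLocalRing.maximalIdeal R ^ k = ⊥ := by
    have := IsArtinianRing.isNilpotent_jacobson_bot (R := R)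
    rw [IsLocalRing.jacobson_eq_maximalIdeal ⊥ bot_ne_top] at this
    exact this
  obtain ⟨k, hk⟩ : ∃ k, Nat.find hnil = k + 1 := by
    refine Nat.exists_eq_succ_of_ne_zero fun h => ?_
    have := Nat.find_spec hnil
    rw [h, pow_zero, Ideal.one_eq_top] at this
    exact top_ne_bot this
  have h1 : IsLocalRing.maximalIdeal R ^ k ≠ ⊥ := Nat.find_min hnil (by omega)
  obtain ⟨s, hs, hs0⟩ := Submodule.exists_mem_ne_zero_of_ne_bot h1
  refine ⟨s, hs0, fun a ha => ?_⟩
  have := Ideal.mul_mem_mul hs ha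
  rwa [← pow_succ, ← hk, Nat.find_spec hnil] at this

lemma Submodule.eq_of_le_of_natCard_le {R V : Type*} [CommRing R] [AddCommGroup V] [Module R V]
    [Finite V] {M N : Submodule R V} (h : M ≤ N)
    (hc : Nat.card N ≤ Nat.card M) : M = N := by
  refine SetLike.coe_injective (Set.eq_of_subset_of_ncard_le h ?_ (Set.toFinite _))
  rwa [← Nat.card_coe_set_eq, ← Nat.card_coe_set_eq]

section

variable {R V : Type*} [CommRing R] [Finite R] [AddCommGroup V] [Module R V]

/-- If multiples by a fixed `s ≠ 0` of elements of `N` are multiples by `s` of combinations of `q`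
elements, then a linearly independent family in `N` has at most `q` elements, since its
combinations with coefficients in `R s` are combinations of the `q` elements with coefficients
in `R s`. -/
lemma le_of_linearIndependent_of_smul {s : R} (hs : s ≠ 0) {N : Submodule R V}
    {r q : ℕ} {v : Fin r → V} (hv : LinearIndependent R v) (hvN : ∀ i, v i ∈ N) {b : Fin q → V}
    (h : ∀ x ∈ N, ∃ w ∈ Submodule.span R (Set.range b), s • x = s • w) : r ≤ q := by
  let I : Set R := Set.range fun a => s * a
  have hI : 1 < Nat.card I := by
    rw [Finite.one_lt_card_iff_nontrivial]
    exact ⟨⟨0, 0, by simp⟩, ⟨s, 1, by simp⟩, fun h => hs (Subtype.ext_iff.1 h).symm⟩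
  have key : ∀ c : Fin r → I, ∃ c' : Fin q → I,
      ∑ i, (c i : R) • v i = ∑ j, (c' j : R) • b j := by
    intro c
    choose a ha using fun i => (c i).2
    obtain ⟨w, hw, hsw⟩ := h (∑ i, a i • v i)
      (N.sum_mem fun i _ => N.smul_mem _ (hvN i))
    obtain ⟨a', rfl⟩ := (Submodule.mem_span_range_iff_exists_fun R).1 hw
    refine ⟨fun j => ⟨s * a' j, a' j, rfl⟩, ?_⟩
    simp only [Finset.smul_sum, smul_smul] at hsw
    rw [← hsw]
    exact Finset.sum_congr rfl fun i _ => by rw [← ha i]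
  choose f hf using key
  have hinj : Function.Injective f := by
    intro c c' hcc
    have h1 : ∑ i, (c i : R) • v i = ∑ i, (c' i : R) • v i := by rw [hf, hf, hcc]
    funext i
    exact Subtype.ext (Fintype.linearIndependent_iffₛ.1 hv _ _ h1 i)
  have := Nat.card_le_card_of_injective f hinj
  rw [Nat.card_fun, Nat.card_fun, Nat.card_fin, Nat.card_fin] at this
  exact (Nat.pow_le_pow_iff_right hI).1 this

variable [Nontrivial R] [Finite V]

lemma natCard_submodule_of_free (N : Submodule R V) [Module.Free R N] :
    Nat.card N = Nat.card R ^ Module.finrank R N := by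
  rw [Nat.card_congr (Module.finBasis R N).equivFun.toEquiv, Nat.card_fun, Nat.card_fin]

lemma bddAbove_ranks (M : Submodule R V) :
    BddAbove {r | ∃ N : Submodule R M, Module.Free R N ∧ Module.finrank R N = r} := by
  refine ⟨Nat.card M, ?_⟩
  rintro r ⟨N, hN, rfl⟩
  have h1 : Nat.card N ≤ Nat.card M := Nat.card_le_card_of_injective _ N.injective_subtype
  rw [natCard_submodule_of_free N] at h1
  exact (Nat.lt_pow_self Finite.one_lt_card).le.trans h1

/-- A submodule of `N` whose free rank is the rank of the free module `N` is equal to `N`. -/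
lemma Submodule.eq_of_le_of_freeRank_eq {M N : Submodule R V} (h : M ≤ N) [Module.Free R N]
    (hr : freeRank R M = Module.finrank R N) : M = N := by
  obtain ⟨L, hL, hr'⟩ := Nat.sSup_mem (s := {r | ∃ N : Submodule R M, Module.Free R N ∧
    Module.finrank R N = r}) ⟨0, ⊥, inferInstance, finrank_bot R M⟩ (bddAbove_ranks M)
  refine Submodule.eq_of_le_of_natCard_le h ?_
  rw [natCard_submodule_of_free N, ← hr, freeRank, ← hr', ← natCard_submodule_of_free L]
  exact Nat.card_le_card_of_injective _ L.injective_subtype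

variable {s : R} {N : Submodule R V} {q : ℕ} {b : Fin q → V}

/-- If multiplication by some `s ≠ 0` does not distinguish `N` from the span of a linearly
independent family in `N`, then the size of this family is the free rank of `N`. -/
lemma freeRank_eq_of_smul (hs : s ≠ 0) (hb : LinearIndependent R b) (hbN : ∀ i, b i ∈ N)
    (h : ∀ x ∈ N, ∃ w ∈ Submodule.span R (Set.range b), s • x = s • w) :
    freeRank R N = q := by
  refine IsGreatest.csSup_eq ⟨?_, ?_⟩
  · have hle : Submodule.span R (Set.range b) ≤ N := Submodule.span_le.2 (by
      rintro _ ⟨i, rfl⟩; exact hbN i)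
    have e := Submodule.comapSubtypeEquivOfLe hle
    have : Module.Free R (Submodule.span R (Set.range b)) := Module.Free.of_basis (.span hb)
    exact ⟨_, Module.Free.of_equiv e.symm, by
      rw [e.finrank_eq, finrank_span_eq_card hb, Fintype.card_fin]⟩
  · rintro r ⟨L, hL, rfl⟩
    have v := Module.finBasis R L
    exact le_of_linearIndependent_of_smul hs (v := fun i => ((v i : N) : V))
      ((v.linearIndependent.map' L.subtype L.ker_subtype).map' N.subtype N.ker_subtype)
      (fun i => (v i : N).2) h

/-- A free module `N` that multiplication by some `s ≠ 0` does not distinguish from the span of a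
linearly independent family in `N` is equal to this span, because its rank, and hence its
cardinality, is not larger. -/
lemma free_iff_of_smul (hs : s ≠ 0) (hb : LinearIndependent R b) (hbN : ∀ i, b i ∈ N)
    (h : ∀ x ∈ N, ∃ w ∈ Submodule.span R (Set.range b), s • x = s • w) :
    Module.Free R N ↔ Submodule.span R (Set.range b) = N := by
  have hle : Submodule.span R (Set.range b) ≤ N := Submodule.span_le.2 (by
    rintro _ ⟨i, rfl⟩; exact hbN i)
  have hfree : Module.Free R (Submodule.span R (Set.range b)) := Module.Free.of_basis (.span hb)
  refine ⟨fun hN => Submodule.eq_of_le_of_natCard_le hle ?_, fun h => h ▸ hfree⟩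
  rw [natCard_submodule_of_free, natCard_submodule_of_free, finrank_span_eq_card hb,
    Fintype.card_fin]
  have v := Module.finBasis R N
  exact Nat.pow_le_pow_right Nat.card_pos (le_of_linearIndependent_of_smul hs
    (v.linearIndependent.map' N.subtype N.ker_subtype) (fun i => (v i).2) h)

end

/-! ### Elimination with unit pivots -/

section

variable {R ι : Type*} [CommRing R]

/-- Subtract multiples of the vectors of a list, the last one first, to make the entries at their
pivots zero. Each vector is listed with its pivot. -/
def red : List (ι × (ι → R)) → (ι → R) →ₗ[R] (ι → R)
  | [] => LinearMap.id
  | x :: B => red B - (LinearMap.proj x.1 ∘ₗ red B).smulRight x.2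

/-- Each vector of the list is one at its pivot and zero at the pivots of later vectors. -/
def Triangular : List (ι × (ι → R)) → Prop
  | [] => True
  | x :: B => x.2 x.1 = 1 ∧ (∀ y ∈ B, x.2 y.1 = 0) ∧ Triangular B

/-- The span of the vectors of a list. -/
def spanVec (B : List (ι × (ι → R))) : Submodule R (ι → R) :=
  Submodule.span R {v | v ∈ B.map Prod.snd}

lemma red_cons (x : ι × (ι → R)) (B : List (ι × (ι → R))) (u : ι → R) :
    red (x :: B) u = red B u - red B u x.1 • x.2 := rfl

lemma spanVec_le_cons (x : ι × (ι → R)) (B : List (ι × (ι → R))) : spanVec B ≤ spanVec (x :: B) :=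
  Submodule.span_mono fun _ h => List.mem_cons_of_mem _ h

lemma mem_spanVec {x : ι × (ι → R)} {B : List (ι × (ι → R))} (h : x ∈ B) : x.2 ∈ spanVec B :=
  Submodule.subset_span (List.mem_map_of_mem h)

variable {B : List (ι × (ι → R))} {u : ι → R}

lemma sub_red_mem (B : List (ι × (ι → R))) (u : ι → R) : u - red B u ∈ spanVec B := by
  induction B with
  | nil => simp [red]
  | cons x B ih =>
    rw [red_cons, sub_sub_eq_add_sub, add_sub_right_comm]
    exact add_mem (spanVec_le_cons _ _ ih)
      (Submodule.smul_mem _ _ (mem_spanVec (List.mem_cons_self)))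

lemma red_eq_self (h : ∀ x ∈ B, u x.1 = 0) : red B u = u := by
  induction B with
  | nil => rfl
  | cons x B ih =>
    rw [red_cons, ih fun y hy => h y (List.mem_cons_of_mem _ hy), h x (List.mem_cons_self),
      zero_smul, sub_zero]

namespace Triangular

lemma red_apply (hB : Triangular B) {x : ι × (ι → R)} (hx : x ∈ B) : red B u x.1 = 0 := by
  induction B with
  | nil => simp at hx
  | cons y B ih =>
    obtain ⟨h₁, h₂, h₃⟩ := hB
    rcases List.mem_cons.1 hx with rfl | hx
    · simp [red_cons, h₁]
    · simp [red_cons, ih h₃ hx, h₂ x hx]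

lemma red_self (hB : Triangular B) {x : ι × (ι → R)} (hx : x ∈ B) : red B x.2 = 0 := by
  induction B with
  | nil => simp at hx
  | cons y B ih =>
    obtain ⟨h₁, h₂, h₃⟩ := hB
    rcases List.mem_cons.1 hx with rfl | hx
    · simp [red_cons, red_eq_self h₂, h₁]
    · simp [red_cons, ih h₃ hx]

lemma red_eq_zero_iff (hB : Triangular B) : red B u = 0 ↔ u ∈ spanVec B := by
  refine ⟨fun h => by simpa [h] using sub_red_mem B u, fun h => ?_⟩
  have : spanVec B ≤ LinearMap.ker (red B) := Submodule.span_le.2 fun v hv => by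
    obtain ⟨x, hx, rfl⟩ := List.mem_map.1 hv
    exact hB.red_self hx
  exact this h

lemma linearIndependent (hB : Triangular B) :
    LinearIndependent R (B.map Prod.snd).get := by
  rw [Fintype.linearIndependent_iff]
  induction B with
  | nil => exact fun _ _ i => absurd i.2 (Nat.not_lt_zero _)
  | cons x B ih =>
    obtain ⟨h₁, h₂, h₃⟩ := hB
    change ∀ g : Fin ((B.map Prod.snd).length + 1) → R,
      ∑ i, g i • (x.2 :: B.map Prod.snd).get i = 0 → ∀ i, g i = 0
    intro g hg
    have hg' : g 0 • x.2 + ∑ i : Fin (B.map Prod.snd).length,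
        g i.succ • (B.map Prod.snd).get i = 0 := by
      rw [← hg]
      exact (Fin.sum_univ_succ fun i => g i • (x.2 :: B.map Prod.snd).get i).symm
    have hmem : ∑ i : Fin (B.map Prod.snd).length, g i.succ • (B.map Prod.snd).get i ∈ spanVec B :=
      (spanVec B).sum_mem fun i _ => (spanVec B).smul_mem _
        (Submodule.subset_span (List.get_mem _ i))
    have h0 : g 0 = 0 := by
      have := congrFun (congrArg (red B) hg') x.1
      rw [map_add, h₃.red_eq_zero_iff.2 hmem, map_smul, red_eq_self h₂] at this
      simpa [h₁] using this
    rw [h0, zero_smul, zero_add] at hg'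
    exact Fin.cases h0 (ih h₃ (fun i => g i.succ) hg')

end Triangular

/-- The list `B` arises by elimination from vectors that span `N`: it is triangular with vectors in
`N`, and modulo these vectors the elements of `N` have entries in the maximal ideal. -/
structure IsElimination [IsLocalRing R] (B : List (ι × (ι → R))) (N : Submodule R (ι → R)) :
    Prop where
  triangular : Triangular B
  mem : ∀ x ∈ B, x.2 ∈ N
  red_mem : ∀ v ∈ N, ∀ i, red B v i ∈ IsLocalRing.maximalIdeal R

namespace IsElimination

variable [IsLocalRing R] {N : Submodule R (ι → R)}

lemma exists_smul_eq {s : R} (hs : ∀ a ∈ IsLocalRing.maximalIdeal R, s * a = 0)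
    (h : IsElimination B N) (x : ι → R) (hx : x ∈ N) :
    ∃ w ∈ Submodule.span R (Set.range (B.map Prod.snd).get), s • x = s • w := by
  refine ⟨x - red B x, ?_, ?_⟩
  · have := sub_red_mem B x
    rwa [spanVec, ← Set.range_list_get] at this
  · have : s • red B x = 0 := funext fun i => hs _ (h.red_mem x hx i)
    rw [smul_sub, this, sub_zero]

lemma get_mem (h : IsElimination B N) (i) : (B.map Prod.snd).get i ∈ N := by
  obtain ⟨x, hx, hxi⟩ := List.mem_map.1 (List.get_mem (B.map Prod.snd) i)
  exact hxi ▸ h.mem x hx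

variable [Finite R] [Finite ι]

lemma freeRank_eq (h : IsElimination B N) : freeRank R N = B.length := by
  obtain ⟨s, hs0, hs⟩ := exists_ne_zero_mul_maximalIdeal R
  rw [freeRank_eq_of_smul hs0 h.triangular.linearIndependent h.get_mem (h.exists_smul_eq hs),
    List.length_map]

lemma free_iff (h : IsElimination B N) : Module.Free R N ↔ spanVec B = N := by
  obtain ⟨s, hs0, hs⟩ := exists_ne_zero_mul_maximalIdeal R
  rw [free_iff_of_smul hs0 h.triangular.linearIndependent h.get_mem (h.exists_smul_eq hs),
    Set.range_list_get, spanVec]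

end IsElimination

end

namespace Comp

variable {d : Sizes} {n : ℕ}

/-- The computation of `red`. -/
def reduce : List (Fin n × (Fin n → Cell d)) → (Fin n → Cell d) → Comp d (Fin n → Cell d)
  | [], u => pure u
  | x :: B, u => do
    let v ← reduce B u
    subSmul v (v x.1) x.2

/-- Extend a triangular list by elimination: reduce the given vectors one after the other, and put
those with a unit entry, normalised, on the list. -/
def eliminate : List (Fin n → Cell d) → List (Fin n × (Fin n → Cell d)) →
    Comp d (List (Fin n × (Fin n → Cell d)))
  | [], B => pure B
  | u :: us, B => do
    let v ← reduce B u
    match ← findUnit v with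
    | none => eliminate us B
    | some (p, c) => do
      let w ← smul c v
      eliminate us ((p, w) :: B)

/-- A triangular list obtained by elimination from the vectors `us`, and whether it spans the same
module as these vectors. -/
def echelon (us : List (Fin n → Cell d)) :
    Comp d (List (Fin n × (Fin n → Cell d)) × Bool) := do
  let B ← eliminate us []
  let t ← all fun i : Fin us.length => do
    let v ← reduce B (us.get i)
    isZero v
  pure (B, t)

end Comp

section

variable {R : Type*} {d : Sizes} {σ τ : MemState d R} {n : ℕ}

/-- The list `B` holds the list `C` of vectors with pivots. -/
def StoresPivots (σ : MemState d R) (B : List (Fin n × (Fin n → Cell d)))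
    (C : List (Fin n × (Fin n → R))) : Prop :=
  List.Forall₂ (fun x y => x.1 = y.1 ∧ Stores σ x.2 y.2) B C

variable {B : List (Fin n × (Fin n → Cell d))} {C : List (Fin n × (Fin n → R))}

lemma StoresPivots.mono (h : StoresPivots σ B C) (hl : σ ≤ τ) : StoresPivots τ B C :=
  List.Forall₂.imp (fun _ _ h => ⟨h.1, h.2.mono hl⟩) h

lemma StoresPivots.storesList (h : StoresPivots σ B C) :
    StoresList σ (B.map Prod.snd) (C.map Prod.snd) := by
  rw [StoresList, List.forall₂_map_left_iff, List.forall₂_map_right_iff]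
  exact h.imp fun _ _ h => h.2

variable [CommRing R] {R₀ : Subring R} {z : Fin d.gam → R}

lemma Triangular.length_le [Nontrivial R] (hC : Triangular C) : C.length ≤ n := by
  simpa using hC.linearIndependent.fintype_card_le_finrank

lemma red_mem_of_red_mem {x : Fin n × (Fin n → R)} {I : Ideal R} {u : Fin n → R}
    (h : ∀ i, red C u i ∈ I) (i : Fin n) : red (x :: C) u i ∈ I :=
  I.sub_mem (h i) (I.mul_mem_right _ (h x.1))

namespace Ensures

lemma reduce (hB : StoresPivots σ B C) {u : Fin n → Cell d} {v : Fin n → R} (hu : Stores σ u v) :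
    Ensures R₀ z (Comp.reduce B u) σ (C.length * (2 * n)) fun a τ => Stores τ a (red C v) := by
  induction hB generalizing u v with
  | nil => exact pure hu
  | cons h hB ih =>
    refine weakenCost (bind (ih hu) fun a τ hτ ha => subSmul ha (ha _) (h.2.mono hτ))
      (by rw [List.length_cons, Nat.succ_mul _ (2 * n)]) |>.weaken le_rfl fun a τ _ ha => ?_
    rw [red_cons, ← h.1]
    exact ha

variable [IsLocalRing R]

lemma eliminate {us : List (Fin n → Cell d)} {vs : List (Fin n → R)} (hus : StoresList σ us vs)
    (hB : StoresPivots σ B C) (hC : Triangular C) :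
    Ensures R₀ z (Comp.eliminate us B) σ (vs.length * (2 * n ^ 2 + 3 * n)) fun B' τ =>
      ∃ C', StoresPivots τ B' C' ∧ Triangular C' ∧
        (∀ N : Submodule R (Fin n → R), (∀ x ∈ C, x.2 ∈ N) → (∀ v ∈ vs, v ∈ N) →
          ∀ x ∈ C', x.2 ∈ N) ∧
        (∀ u, (∀ i, red C u i ∈ IsLocalRing.maximalIdeal R) →
          ∀ i, red C' u i ∈ IsLocalRing.maximalIdeal R) ∧
        ∀ v ∈ vs, ∀ i, red C' v i ∈ IsLocalRing.maximalIdeal R := by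
  induction us generalizing vs B C σ with
  | nil =>
    obtain rfl := List.forall₂_nil_left_iff.1 hus
    exact pure ⟨C, hB, hC, fun _ h _ => h, fun _ h => h, by simp⟩
  | cons u us ih =>
    obtain ⟨v, vs, hu, hus', rfl⟩ := List.forall₂_cons_left_iff.1 hus
    replace hus' : StoresList σ us vs := hus'
    have hcost : C.length * (2 * n) ≤ 2 * n ^ 2 := by
      have := Nat.mul_le_mul_right (2 * n) hC.length_le
      rwa [show n * (2 * n) = 2 * n ^ 2 by ring] at this
    refine weakenCost (bind (reduce hB hu) fun a τ hτ ha => bind (findUnit ha)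
      (N' := n + vs.length * (2 * n ^ 2 + 3 * n)) fun t ρ hρ ht => ?_)
      (by rw [List.length_cons, Nat.succ_mul vs.length]; omega)
    rcases t with _ | ⟨p, c⟩
    · have hred : ∀ i, red C v i ∈ IsLocalRing.maximalIdeal R := ht
      refine (ih (hus'.mono (hτ.trans hρ))
        (hB.mono (hτ.trans hρ)) hC).weaken (by omega) ?_
      rintro B' π - ⟨C', h1, h2, h3, h4, h5⟩
      refine ⟨C', h1, h2, fun N hN hv => h3 N hN fun w hw => hv w (List.mem_cons_of_mem _ hw), h4,
        ?_⟩
      intro w hw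
      rcases List.mem_cons.1 hw with rfl | hw
      · exact h4 _ hred
      · exact h5 w hw
    · obtain ⟨hunit, hc⟩ := ht
      refine bind (smul hc (ha.mono hρ)) fun w π hπ hw => ?_
      set x : Fin n × (Fin n → R) := (p, Ring.inverse (red C v p) • red C v) with hx
      have hC' : Triangular (x :: C) := by
        refine ⟨Ring.inverse_mul_cancel _ hunit, fun y hy => ?_, hC⟩
        simp [hx, hC.red_apply hy]
      have hσ := (hτ.trans hρ).trans hπ
      refine (ih (C := x :: C) (hus'.mono hσ)
        (List.Forall₂.cons ⟨rfl, hw⟩ (hB.mono hσ)) hC').weaken le_rfl ?_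
      rintro B' π - ⟨C', h1, h2, h3, h4, h5⟩
      refine ⟨C', h1, h2, fun N hN hv => h3 N ?_ fun w hw => hv w (List.mem_cons_of_mem _ hw),
        fun u hu => h4 u fun i => red_mem_of_red_mem hu i, ?_⟩
      · intro y hy
        rcases List.mem_cons.1 hy with rfl | hy
        · refine N.smul_mem _ ?_
          have h6 : spanVec C ≤ N := Submodule.span_le.2 fun v hv => by
            obtain ⟨y, hy, rfl⟩ := List.mem_map.1 hv
            exact hN y hy
          have := N.sub_mem (hv v List.mem_cons_self) (h6 (sub_red_mem C v))
          rwa [sub_sub_cancel] at this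
        · exact hN y hy
      · intro w hw
        rcases List.mem_cons.1 hw with rfl | hw
        · -- The new vector is a multiple of the reduced one, hence it reduces to zero.
          refine h4 _ fun i => ?_
          have : red (x :: C) w = 0 := by
            rw [red_cons, hx, smul_smul, Ring.mul_inverse_cancel _ hunit, one_smul, sub_self]
          rw [this]
          exact zero_mem _
        · exact h5 w hw

lemma echelon {us : List (Fin n → Cell d)} {vs : List (Fin n → R)} (hus : StoresList σ us vs) :
    Ensures R₀ z (Comp.echelon us) σ (vs.length * (4 * n ^ 2 + 4 * n)) fun a τ =>
      ∃ C, StoresPivots τ a.1 C ∧ IsElimination C (Submodule.span R {v | v ∈ vs}) ∧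
        (a.2 = true ↔ spanVec C = Submodule.span R {v | v ∈ vs}) := by
  refine weakenCost (bind (eliminate hus (B := []) (C := []) List.Forall₂.nil trivial)
    (N' := vs.length * (2 * n ^ 2 + n)) ?_) (le_of_eq (by ring))
  rintro B τ hτ ⟨C, hB, hC, h1, -, h2⟩
  have hcost : C.length * (2 * n) ≤ 2 * n ^ 2 := by
    have := Nat.mul_le_mul_right (2 * n) hC.length_le
    rwa [show n * (2 * n) = 2 * n ^ 2 by ring] at this
  have hmem := h1 _ (by simp) (fun v hv => Submodule.subset_span hv)
  refine (bind (all (N := 2 * n ^ 2 + n) (P := fun i : Fin us.length =>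
    red C (vs.get (i.cast hus.length_eq)) = 0) fun i ρ hρ => ?_)
    fun t ρ hρ ht => pure (N := 0) ?_).weakenCost (by rw [hus.length_eq, add_zero])
  · have hi : Stores ρ (us.get i) (vs.get (i.cast hus.length_eq)) :=
      (hus.get i.2 (i.cast hus.length_eq).2).mono (hτ.trans hρ)
    exact weakenCost (bind (reduce (hB.mono hρ) hi) fun a π _ ha => isZero ha) (by omega)
  · refine ⟨C, hB.mono hρ, ⟨hC, hmem, ?_⟩, ?_⟩
    · let M : Submodule R (Fin n → R) :=
        (Submodule.pi Set.univ fun _ => IsLocalRing.maximalIdeal R).comap (red C)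
      have : Submodule.span R {v | v ∈ vs} ≤ M :=
        Submodule.span_le.2 fun v hv i _ => h2 v hv i
      exact fun v hv i => this hv i trivial
    · have hle : spanVec C ≤ Submodule.span R {v | v ∈ vs} := Submodule.span_le.2 fun v hv => by
        obtain ⟨y, hy, rfl⟩ := List.mem_map.1 hv
        exact hmem y hy
      have h3 : t = true ↔ ∀ v ∈ vs, red C v = 0 := by
        rw [ht]
        refine ⟨fun h v hv => ?_, fun h i => h _ (List.get_mem _ _)⟩
        obtain ⟨i, rfl⟩ := List.get_of_mem hv
        exact h (i.cast hus.length_eq.symm)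
      show t = true ↔ _
      rw [h3]
      refine ⟨fun h => le_antisymm hle (Submodule.span_le.2 fun v hv =>
        hC.red_eq_zero_iff.1 (h v hv)), fun h v hv => hC.red_eq_zero_iff.2 ?_⟩
      rw [h]
      exact Submodule.subset_span hv

end Ensures

end

/-! ### Galois rings -/

/-- If every element that is not a unit is divisible by a fixed nilpotent element, then any two
elements are comparable for divisibility, since each is a unit times a power of this element. -/
lemma dvd_total_of_isNilpotent {A : Type*} [CommRing A] {π : A} (hπ : IsNilpotent π)
    (h : ∀ x : A, IsUnit x ∨ π ∣ x) (x y : A) : x ∣ y ∨ y ∣ x := by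
  obtain ⟨N, hN⟩ := hπ
  have key : ∀ x : A, ∃ i, ∃ u : Aˣ, x = u * π ^ i := by
    intro x
    have : ∀ k, (∃ i, ∃ u : Aˣ, x = u * π ^ i) ∨ π ^ k ∣ x := by
      intro k
      induction k with
      | zero => exact Or.inr (by simp)
      | succ k ih =>
        rcases ih with ih | ⟨y, rfl⟩
        · exact Or.inl ih
        · rcases h y with ⟨u, rfl⟩ | hy
          · exact Or.inl ⟨k, u, mul_comm _ _⟩
          · exact Or.inr (by rw [pow_succ]; exact mul_dvd_mul_left _ hy)
    rcases this N with h | h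
    · exact h
    · rw [hN, zero_dvd_iff] at h
      exact ⟨N, 1, by rw [h, hN, mul_zero]⟩
  obtain ⟨i, u, rfl⟩ := key x
  obtain ⟨j, v, rfl⟩ := key y
  rcases le_total i j with hij | hij
  · left
    rw [Units.mul_left_dvd, Units.dvd_mul_left]
    exact pow_dvd_pow _ hij
  · right
    rw [Units.mul_left_dvd, Units.dvd_mul_left]
    exact pow_dvd_pow _ hij

lemma AdjoinRoot.isNilpotent_prime {p e : ℕ} (h : (ZMod (p ^ e))[X]) :
    IsNilpotent (p : AdjoinRoot h) := by
  refine ⟨e, ?_⟩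
  have h1 : ((p ^ e : ℕ) : AdjoinRoot h) = AdjoinRoot.of h ((p ^ e : ℕ) : ZMod (p ^ e)) :=
    (map_natCast _ _).symm
  rw [ZMod.natCast_self, map_zero, Nat.cast_pow] at h1
  exact h1

/-- In the Galois ring `(ℤ / p ^ e)[X] / (h)` an element is a unit or divisible by `p`, since the
quotient by `p` is the field `𝔽_p[X] / (h)`. -/
lemma AdjoinRoot.isUnit_or_dvd {p e : ℕ} [hp : Fact p.Prime] (he : e ≠ 0) {h : (ZMod (p ^ e))[X]}
    (hirr : Irreducible (h.map (ZMod.castHom (dvd_pow_self p he) (ZMod p)))) (x : AdjoinRoot h) :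
    IsUnit x ∨ (p : AdjoinRoot h) ∣ x := by
  obtain ⟨g, rfl⟩ := AdjoinRoot.mk_surjective x
  set ρ := ZMod.castHom (dvd_pow_self p he) (ZMod p) with hρ
  have hsurj : Function.Surjective (Polynomial.map ρ) :=
    Polynomial.map_surjective _ (ZMod.castHom_surjective _)
  -- A polynomial that is zero modulo `p` is a multiple of `p`.
  have hker : ∀ q : (ZMod (p ^ e))[X], q.map ρ = 0 → (p : AdjoinRoot h) ∣ AdjoinRoot.mk h q := by
    intro q hq
    have h1 : C (p : ZMod (p ^ e)) ∣ q := by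
      rw [Polynomial.C_dvd_iff_dvd_coeff]
      intro i
      have h2 : ρ (q.coeff i) = 0 := by
        rw [← Polynomial.coeff_map, hq, Polynomial.coeff_zero]
      obtain ⟨c, hc⟩ := ZMod.intCast_surjective (q.coeff i)
      rw [← hc, map_intCast, ZMod.intCast_zmod_eq_zero_iff_dvd] at h2
      rw [← hc]
      obtain ⟨k, rfl⟩ := h2
      exact ⟨(k : ZMod (p ^ e)), by push_cast; rfl⟩
    have h2 := map_dvd (AdjoinRoot.mk h) h1
    simpa using h2
  rcases (EuclideanDomain.dvd_or_coprime _ (g.map ρ) hirr) with hdvd | hcop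
  · right
    obtain ⟨w, hw⟩ := hdvd
    obtain ⟨w, rfl⟩ := hsurj w
    have := hker (g - h * w) (by rw [Polynomial.map_sub, Polynomial.map_mul, hw, sub_self])
    simpa using this
  · left
    obtain ⟨a, b, hab⟩ := hcop
    obtain ⟨a, rfl⟩ := hsurj a
    obtain ⟨b, rfl⟩ := hsurj b
    obtain ⟨c, hc⟩ := hker (a * h + b * g - 1) (by
      rw [Polynomial.map_sub, Polynomial.map_add, Polynomial.map_mul, Polynomial.map_mul, hab,
        Polynomial.map_one, sub_self])
    have h1 : AdjoinRoot.mk h b * AdjoinRoot.mk h g = 1 + p * c := by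
      simp at hc
      rw [← hc]
      ring
    have h2 : IsUnit (1 + p * c) :=
      IsNilpotent.isUnit_one_add ((Commute.all _ _).isNilpotent_mul_right (isNilpotent_prime h))
    rw [← h1] at h2
    exact isUnit_of_mul_isUnit_right h2

section

variable {R : Type*} [CommRing R]

lemma IsMaximalGaloisSubring.dvd_total [IsLocalRing R] {R₀ : Subring R}
    (h : IsMaximalGaloisSubring R₀) (x y : R₀) : x ∣ y ∨ y ∣ x := by
  obtain ⟨p, e, -, he, h, hp, -, -, -, -, hirr, ⟨φ⟩⟩ := h
  have : Fact p.Prime := ⟨hp⟩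
  have := dvd_total_of_isNilpotent (AdjoinRoot.isNilpotent_prime h)
    (AdjoinRoot.isUnit_or_dvd he hirr) (φ x) (φ y)
  simpa [map_dvd_iff] using this

/-- In a finite set of elements that are pairwise comparable for divisibility one divides all. -/
lemma exists_forall_dvd {A : Type*} [CommRing A] (h : ∀ x y : A, x ∣ y ∨ y ∣ x) {s : Finset A}
    (hs : s.Nonempty) : ∃ g ∈ s, ∀ c ∈ s, g ∣ c := by
  classical
  induction hs using Finset.Nonempty.cons_induction with
  | singleton a => exact ⟨a, by simp⟩
  | cons a s ha hs ih =>
    obtain ⟨g, hg, hgs⟩ := ih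
    rcases h a g with hag | hga
    · refine ⟨a, by simp, fun c hc => ?_⟩
      rcases Finset.mem_cons.1 hc with rfl | hc
      · exact dvd_rfl
      · exact hag.trans (hgs c hc)
    · refine ⟨g, by simp [hg], fun c hc => ?_⟩
      rcases Finset.mem_cons.1 hc with rfl | hc
      · exact hga
      · exact hgs c hc

variable {R₀ : Subring R}

lemma galoisQuot_mem (x y : R) : galoisQuot R₀ x y ∈ R₀ := by
  unfold galoisQuot
  split_ifs with h
  · exact h.2.choose_spec.1
  · exact zero_mem _

lemma mul_galoisQuot {x y : R₀} (h : y ∣ x) : (y : R) * galoisQuot R₀ (x : R) y = x := by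
  have h' : (y : R) ∈ R₀ ∧ ∃ c ∈ R₀, (y : R) * c = x := by
    obtain ⟨c, rfl⟩ := h
    exact ⟨y.2, c, c.2, rfl⟩
  unfold galoisQuot
  rw [dif_pos h']
  exact h'.2.choose_spec.2

lemma galoisAnn_spec [Finite R] (h : ∀ x y : R₀, x ∣ y ∨ y ∣ x) (x : R) :
    galoisAnn R₀ x ∈ R₀ ∧
      ∀ c ∈ R₀, c * x = 0 ↔ ∃ a ∈ R₀, c = a * galoisAnn R₀ x := by
  have h' : ∃ g ∈ R₀, ∀ c ∈ R₀, c * x = 0 ↔ ∃ a ∈ R₀, c = a * g := by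
    have hfin : {c : R₀ | (c : R) * x = 0}.Finite := Set.toFinite _
    obtain ⟨g, hg, hgs⟩ := exists_forall_dvd h (s := hfin.toFinset) ⟨0, by simp⟩
    refine ⟨g, g.2, fun c hc => ⟨fun hcx => ?_, ?_⟩⟩
    · obtain ⟨a, ha⟩ := hgs ⟨c, hc⟩ (by simpa using hcx)
      exact ⟨a, a.2, by simpa [mul_comm] using congrArg Subtype.val ha⟩
    · rintro ⟨a, -, rfl⟩
      have : (g : R) * x = 0 := by simpa using hg
      rw [mul_assoc, this, mul_zero]
  unfold galoisAnn
  rw [dif_pos h']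
  exact h'.choose_spec

variable {γ : ℕ} {z : Fin γ → R}

lemma galoisCoord_mem (x : R) (i : Fin γ) : galoisCoord R₀ z x i ∈ R₀ := by
  unfold galoisCoord
  split_ifs with h
  · exact (h.choose i).2
  · exact zero_mem _

lemma exists_sum_generators (hz : DirectSum.IsInternal fun a => Submodule.span R₀ {z a}) (x : R) :
    ∃ c : Fin γ → R₀, x = ∑ a, (c a : R) * z a := by
  have h1 : x ∈ ⨆ a, Submodule.span R₀ {z a} := by
    rw [hz.submodule_iSup_eq_top]
    trivial
  rw [← Submodule.span_range_eq_iSup, Submodule.mem_span_range_iff_exists_fun] at h1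
  obtain ⟨c, hc⟩ := h1
  exact ⟨c, hc.symm⟩

lemma sum_galoisCoord (hz : DirectSum.IsInternal fun a => Submodule.span R₀ {z a}) (x : R) :
    ∑ a, galoisCoord R₀ z x a * z a = x := by
  have h := exists_sum_generators hz x
  have h' : ∀ a, galoisCoord R₀ z x a = h.choose a := fun a => by
    unfold galoisCoord
    rw [dif_pos h]
  simp only [h']
  exact h.choose_spec.symm

/-- The summands `R₀ z_i` need not be free, so the coefficients of an element are not unique, but
its components in the summands are. -/
lemma galoisCoord_mul_eq (hz : DirectSum.IsInternal fun a => Submodule.span R₀ {z a})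
    (c : Fin γ → R₀) (i : Fin γ) :
    galoisCoord R₀ z (∑ a, (c a : R) * z a) i * z i = c i * z i := by
  have h1 := sum_galoisCoord hz (∑ a, (c a : R) * z a)
  have hind := hz.submodule_iSupIndep
  rw [iSupIndep_iff_finsetSum_eq_zero_imp_eq_zero] at hind
  set x := ∑ a, (c a : R) * z a with hx
  have h2 : ∀ c : R, c ∈ R₀ → ∀ a, c * z a ∈ Submodule.span R₀ {z a} := fun c hc a =>
    Submodule.mem_span_singleton.2 ⟨⟨c, hc⟩, rfl⟩
  have h3 := hind Finset.univ (fun a => galoisCoord R₀ z x a * z a - c a * z a)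
    (fun a _ => sub_mem (h2 _ (galoisCoord_mem _ _) a) (h2 _ (c a).2 a))
    (by rw [Finset.sum_sub_distrib, h1, ← hx, sub_self]) i (Finset.mem_univ i)
  exact sub_eq_zero.1 h3

/-- The projections of `R` onto the summands `R₀ z_a`, computed by `galoisCoord`, are linear. -/
lemma exists_projections (hz : DirectSum.IsInternal fun a => Submodule.span R₀ {z a}) :
    ∃ π : Fin γ → R →ₗ[R₀] R, (∀ a x, π a x = galoisCoord R₀ z x a * z a) ∧
      ∀ x, ∑ a, π a x = x := by
  refine ⟨fun a =>
    { toFun := fun x => galoisCoord R₀ z x a * z a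
      map_add' := fun x y => ?_
      map_smul' := fun c x => ?_ }, fun _ _ => rfl, sum_galoisCoord hz⟩
  · obtain ⟨c, rfl⟩ := exists_sum_generators hz x
    obtain ⟨c', rfl⟩ := exists_sum_generators hz y
    have : ∑ a, (c a : R) * z a + ∑ a, (c' a : R) * z a = ∑ a, ((c a + c' a : R₀) : R) * z a := by
      rw [← Finset.sum_add_distrib]
      exact Finset.sum_congr rfl fun a _ => by push_cast; ring
    rw [this, galoisCoord_mul_eq hz, galoisCoord_mul_eq hz, galoisCoord_mul_eq hz]
    push_cast
    ring
  · obtain ⟨c', rfl⟩ := exists_sum_generators hz x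
    have : c • ∑ a, (c' a : R) * z a = ∑ a, ((c * c' a : R₀) : R) * z a := by
      rw [Finset.smul_sum]
      exact Finset.sum_congr rfl fun a _ => by rw [Subring.smul_def]; push_cast; ring
    rw [this, galoisCoord_mul_eq hz, galoisCoord_mul_eq hz, RingHom.id_apply, Subring.smul_def]
    push_cast
    ring

end

/-! ### Linear systems over a finite local ring -/

namespace Comp

variable {d : Sizes} {n k : ℕ}

/-- The coordinate at `i` over the Galois subring of the dot product of `a` and `u`. -/
def coordDot (a : Fin n → Cell d) (i : Fin d.gam) (u : Fin n → Cell d) : Comp d (Cell d) := do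
  let v ← dot a u
  op (.coord i v)

/-- Subtract multiples from vectors to make all but one of the values `coordDot a i` zero. The
arguments are the vector to subtract, with its value, and the remaining vectors. If the value of the
next vector is not a multiple of the current one, then it divides the current one, and the two
vectors change their roles. -/
def sweep (a : Fin n → Cell d) (i : Fin d.gam) : (Fin n → Cell d) → Cell d →
    List (Fin n → Cell d) → Comp d ((Fin n → Cell d) × Cell d × List (Fin n → Cell d))
  | w, cw, [] => pure (w, cw, [])
  | w, cw, u :: us => do
    let cu ← coordDot a i u
    let q ← op (.quot cu cw)
    let p ← op (.mul cw q)
    let t ← op (.sub p cu)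
    ifZ t
      (do
        let u' ← subSmul u q w
        let r ← sweep a i w cw us
        pure (r.1, r.2.1, u' :: r.2.2))
      (do
        let q' ← op (.quot cw cu)
        let w' ← subSmul w q' u
        let r ← sweep a i u cu us
        pure (r.1, r.2.1, w' :: r.2.2))

/-- From generators over the Galois subring of a module of vectors, compute generators of the
submodule on which the component at `i` of the dot product with `a` is zero. -/
def restrict (a : Fin n → Cell d) (i : Fin d.gam) :
    List (Fin n → Cell d) → Comp d (List (Fin n → Cell d))
  | [] => pure []
  | w :: us => do
    let cw ← coordDot a i w
    let r ← sweep a i w cw us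
    let t ← op (.mul r.2.1 (.inl (.generator i)))
    let g ← op (.ann t)
    let w' ← smul g r.1
    pure (w' :: r.2.2)

/-- Apply `restrict` for each equation of a list. -/
def restrictAll : List ((Fin n → Cell d) × Fin d.gam) → List (Fin n → Cell d) →
    Comp d (List (Fin n → Cell d))
  | [], us => pure us
  | e :: es, us => do
    let vs ← restrict e.1 e.2 us
    restrictAll es vs

/-- Generators of the kernel of a matrix. -/
def kernel (A : Fin k → Fin n → Cell d) : Comp d (List (Fin n → Cell d)) := do
  let o ← zero
  restrictAll ((List.finRange k ×ˢ List.finRange d.gam).map fun e => (A e.1, e.2))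
    ((List.finRange n ×ˢ List.finRange d.gam).map fun e j =>
      if j = e.1 then .inl (.generator e.2) else o)

/-- Find a vector in a list whose last entry is a unit, and normalise it to have the last entry
`-1`. The result lacks this entry. -/
def findSolution : List (Fin (n + 1) → Cell d) → Comp d (Option (Fin n → Cell d))
  | [] => pure none
  | u :: us => do
    let c ← op (.inv (u (Fin.last n)))
    ifZ c (findSolution us) (do
      let o ← zero
      let c' ← op (.sub o c)
      let x ← smul c' fun i => u i.castSucc
      pure (some x))

/-- Solve a system of linear equations with the matrix `A` and the right-hand side `v`. -/
def solve (A : Fin k → Fin n → Cell d) (v : Fin k → Cell d) :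
    Comp d (Option (Fin n → Cell d)) := do
  let us ← kernel fun i => Fin.snoc (α := fun _ => Cell d) (A i) (v i)
  findSolution us

end Comp

section

variable {R : Type*} [CommRing R] {R₀ : Subring R} {n : ℕ}

lemma span_sub_smul_sup {c : R} (hc : c ∈ R₀) (u w : Fin n → R) :
    Submodule.span R₀ {u - c • w} ⊔ Submodule.span R₀ {w} =
      Submodule.span R₀ {u} ⊔ Submodule.span R₀ {w} := by
  have hw : ∀ N : Submodule R₀ (Fin n → R), w ∈ N → c • w ∈ N := fun N h =>
    N.smul_mem (⟨c, hc⟩ : R₀) h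
  refine le_antisymm (sup_le ?_ le_sup_right) (sup_le ?_ le_sup_right)
  · rw [Submodule.span_singleton_le_iff_mem]
    exact sub_mem (Submodule.mem_sup_left (Submodule.mem_span_singleton_self _))
      (hw _ (Submodule.mem_sup_right (Submodule.mem_span_singleton_self _)))
  · have h1 : u - c • w ∈ Submodule.span R₀ {u - c • w} ⊔ Submodule.span R₀ {w} :=
      Submodule.mem_sup_left (Submodule.mem_span_singleton_self _)
    rw [Submodule.span_singleton_le_iff_mem]
    have h2 := add_mem h1 (hw _ (Submodule.mem_sup_right (Submodule.mem_span_singleton_self _)))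
    rwa [sub_add_cancel] at h2

lemma span_list_cons {M : Type*} {A : Type*} [CommRing A] [AddCommGroup M] [Module A M] (x : M)
    (l : List M) : Submodule.span A {y | y ∈ x :: l} =
      Submodule.span A {x} ⊔ Submodule.span A {y | y ∈ l} := by
  rw [← Submodule.span_union]
  congr 1
  ext y
  simp

variable {d : Sizes} {z : Fin d.gam → R} {σ : MemState d R}

/-- A cell for each generator of the ring over its Galois subring is among the input cells. -/
def StoresGenerators (σ : MemState d R) (z : Fin d.gam → R) : Prop :=
  Stores σ (fun a => .inl (.generator a)) z

namespace Ensures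

lemma coordDot {a u : Fin n → Cell d} {va vu : Fin n → R} (i : Fin d.gam) (ha : Stores σ a va)
    (hu : Stores σ u vu) :
    Ensures R₀ z (Comp.coordDot a i u) σ (2 * n + 3) fun c τ =>
      Holds τ c (galoisCoord R₀ z (va ⬝ᵥ vu) i) :=
  weakenCost (bind (dot ha hu) fun _ _ _ h => coord i h) le_rfl

variable {a : Fin n → Cell d} {va : Fin n → R} {i : Fin d.gam} {φ : (Fin n → R) →ₗ[R₀] R}

lemma sweep (hR₀ : ∀ x y : R₀, x ∣ y ∨ y ∣ x)
    (hφ : ∀ u, φ u = galoisCoord R₀ z (va ⬝ᵥ u) i * z i) (ha : Stores σ a va)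
    {w : Fin n → Cell d} {cw : Cell d} {us : List (Fin n → Cell d)} {vw : Fin n → R}
    {vs : List (Fin n → R)} (hw : Stores σ w vw)
    (hcw : Holds σ cw (galoisCoord R₀ z (va ⬝ᵥ vw) i)) (hus : StoresList σ us vs) :
    Ensures R₀ z (Comp.sweep a i w cw us) σ (vs.length * (4 * n + 8)) fun r τ =>
      ∃ vw' vs', Stores τ r.1 vw' ∧ Holds τ r.2.1 (galoisCoord R₀ z (va ⬝ᵥ vw') i) ∧
        StoresList τ r.2.2 vs' ∧ vs'.length = vs.length ∧
        Submodule.span R₀ {x | x ∈ vw' :: vs'} = Submodule.span R₀ {x | x ∈ vw :: vs} ∧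
        ∀ x ∈ vs', φ x = 0 := by
  induction us generalizing vs w cw vw σ with
  | nil =>
    obtain rfl := List.forall₂_nil_left_iff.1 hus
    exact pure ⟨vw, [], hw, hcw, List.Forall₂.nil, rfl, rfl, by simp⟩
  | cons u us ih =>
    obtain ⟨vu, vs, hu, hus', rfl⟩ := List.forall₂_cons_left_iff.1 hus
    replace hus' : StoresList σ us vs := hus'
    refine weakenCost (bind (coordDot i ha hu) fun cu τ₁ h₁ hcu =>
      bind (quot hcu (hcw.mono h₁)) fun q τ₂ h₂ hq =>
      bind (mul (hcw.mono (h₁.trans h₂)) hq) fun p τ₃ h₃ hp =>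
      bind (sub hp (hcu.mono (h₂.trans h₃))) fun t τ₄ h₄ ht =>
      ifZ (N := 1 + 2 * n + vs.length * (4 * n + 8)) ht (fun h0 => ?_) (fun h0 => ?_))
      (by rw [List.length_cons, Nat.succ_mul vs.length]; omega)
    · have hσ : σ ≤ τ₄ := ((h₁.trans h₂).trans h₃).trans h₄
      set c := galoisQuot R₀ (galoisCoord R₀ z (va ⬝ᵥ vu) i) (galoisCoord R₀ z (va ⬝ᵥ vw) i)
        with hc
      have hcR : c ∈ R₀ := galoisQuot_mem _ _
      refine weakenCost (bind (subSmul (hu.mono hσ) (hq.mono (h₃.trans h₄)) (hw.mono hσ))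
        fun u' τ₅ h₅ hu' => bind (ih (ha.mono (hσ.trans h₅)) (hw.mono (hσ.trans h₅))
          (hcw.mono (hσ.trans h₅)) (hus'.mono (hσ.trans h₅))) fun r τ₆ h₆ hr => pure (N := 0) ?_)
        (by omega)
      obtain ⟨vw', vs', k1, k2, k3, k4, k5, k6⟩ := hr
      refine ⟨vw', (vu - c • vw) :: vs', k1, k2, List.Forall₂.cons (hu'.mono h₆) k3, by simp [k4],
        ?_, ?_⟩
      · rw [span_list_cons, span_list_cons, sup_left_comm, ← span_list_cons, k5, span_list_cons,
          span_list_cons, span_list_cons, ← sup_assoc, span_sub_smul_sup hcR, sup_assoc,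
          sup_left_comm]
      · intro x hx
        rcases List.mem_cons.1 hx with rfl | hx
        · have : c • vw = (⟨c, hcR⟩ : R₀) • vw := rfl
          rw [map_sub, this, map_smul, hφ, hφ, Subring.smul_def, smul_eq_mul]
          linear_combination -z i * h0
        · exact k6 x hx
    · have hσ : σ ≤ τ₄ := ((h₁.trans h₂).trans h₃).trans h₄
      have hτ : τ₁ ≤ τ₄ := (h₂.trans h₃).trans h₄
      set c := galoisQuot R₀ (galoisCoord R₀ z (va ⬝ᵥ vw) i) (galoisCoord R₀ z (va ⬝ᵥ vu) i)
        with hc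
      have hcR : c ∈ R₀ := galoisQuot_mem _ _
      have hdvd : galoisCoord R₀ z (va ⬝ᵥ vu) i * c = galoisCoord R₀ z (va ⬝ᵥ vw) i := by
        rcases hR₀ ⟨_, galoisCoord_mem (va ⬝ᵥ vw) i⟩ ⟨_, galoisCoord_mem (va ⬝ᵥ vu) i⟩ with h | h
        · exact absurd (sub_eq_zero.2 (mul_galoisQuot h)) h0
        · exact mul_galoisQuot h
      refine weakenCost (bind (quot (hcw.mono hσ) (hcu.mono hτ)) fun q' τ₅ h₅ hq' =>
        bind (subSmul (hw.mono (hσ.trans h₅)) hq' (hu.mono (hσ.trans h₅)))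
        fun w' τ₆ h₆ hw' => bind (ih (ha.mono ((hσ.trans h₅).trans h₆))
          (hu.mono ((hσ.trans h₅).trans h₆)) (hcu.mono ((hτ.trans h₅).trans h₆))
          (hus'.mono ((hσ.trans h₅).trans h₆))) fun r τ₇ h₇ hr => pure (N := 0) ?_)
        (by omega)
      obtain ⟨vw', vs', k1, k2, k3, k4, k5, k6⟩ := hr
      refine ⟨vw', (vw - c • vu) :: vs', k1, k2, List.Forall₂.cons (hw'.mono h₇) k3, by simp [k4],
        ?_, ?_⟩
      · rw [span_list_cons, span_list_cons, sup_left_comm, ← span_list_cons, k5, span_list_cons,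
          span_list_cons, span_list_cons, ← sup_assoc, span_sub_smul_sup hcR, sup_assoc]
      · intro x hx
        rcases List.mem_cons.1 hx with rfl | hx
        · have : c • vu = (⟨c, hcR⟩ : R₀) • vu := rfl
          rw [map_sub, this, map_smul, hφ, hφ, Subring.smul_def, smul_eq_mul]
          linear_combination -z i * hdvd
        · exact k6 x hx

lemma restrict [Finite R] (hR₀ : ∀ x y : R₀, x ∣ y ∨ y ∣ x)
    (hφ : ∀ u, φ u = galoisCoord R₀ z (va ⬝ᵥ u) i * z i) (ha : Stores σ a va)
    (hz : StoresGenerators σ z) {us : List (Fin n → Cell d)} {vs : List (Fin n → R)}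
    (hus : StoresList σ us vs) :
    Ensures R₀ z (Comp.restrict a i us) σ (vs.length * (4 * n + 8)) fun r τ =>
      ∃ vs', StoresList τ r vs' ∧ vs'.length = vs.length ∧
        Submodule.span R₀ {x | x ∈ vs'} = Submodule.span R₀ {x | x ∈ vs} ⊓ LinearMap.ker φ := by
  cases us with
  | nil =>
    obtain rfl := List.forall₂_nil_left_iff.1 hus
    exact pure ⟨[], List.Forall₂.nil, rfl, by simp⟩
  | cons w us =>
    obtain ⟨vw, vs, hw, hus', rfl⟩ := List.forall₂_cons_left_iff.1 hus
    replace hus' : StoresList σ us vs := hus'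
    refine weakenCost (bind (coordDot i ha hw) fun cw τ₁ h₁ hcw =>
      bind (sweep hR₀ hφ (ha.mono h₁) (hw.mono h₁) hcw (hus'.mono h₁)) fun r τ₂ h₂ hr =>
        (?_ : Ensures R₀ z _ τ₂ (2 + n) _))
      (by rw [List.length_cons, Nat.succ_mul vs.length]; omega)
    obtain ⟨vw', vs', k1, k2, k3, k4, k5, k6⟩ := hr
    refine weakenCost (bind (mul k2 ((hz i).mono (h₁.trans h₂))) fun t τ₃ h₃ ht =>
      bind (ann ht) fun g τ₄ h₄ hg => bind (smul hg (k1.mono (h₃.trans h₄))) fun w' τ₅ h₅ hw' =>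
      pure (N := 0) ?_) (by omega)
    have h1 := galoisAnn_spec hR₀ (galoisCoord R₀ z (va ⬝ᵥ vw') i * z i)
    rw [← hφ] at h1 hw'
    set g := galoisAnn R₀ (φ vw')
    refine ⟨(g • vw') :: vs', List.Forall₂.cons hw' (k3.mono ((h₃.trans h₄).trans h₅)),
      by simp [k4], ?_⟩
    rw [← k5]
    have hle : Submodule.span R₀ {x | x ∈ vs'} ≤ LinearMap.ker φ := Submodule.span_le.2 k6
    have hg : g • vw' = (⟨g, h1.1⟩ : R₀) • vw' := rfl
    rw [span_list_cons, span_list_cons]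
    refine le_antisymm (sup_le ?_ (le_inf le_sup_right hle)) ?_
    · rw [Submodule.span_singleton_le_iff_mem, hg]
      refine ⟨Submodule.smul_mem _ _
        (Submodule.mem_sup_left (Submodule.mem_span_singleton_self _)), ?_⟩
      rw [SetLike.mem_coe, LinearMap.mem_ker, map_smul]
      exact (h1.2 g h1.1).2 ⟨1, one_mem _, (one_mul g).symm⟩
    · rintro x ⟨hx, hx0⟩
      obtain ⟨y, hy, y', hy', rfl⟩ := Submodule.mem_sup.1 hx
      obtain ⟨c, rfl⟩ := Submodule.mem_span_singleton.1 hy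
      have h2 : (c : R) * φ vw' = 0 := by
        have h3 : φ (c • vw' + y') = 0 := hx0
        rwa [map_add, show φ y' = 0 from hle hy', add_zero, map_smul, Subring.smul_def] at h3
      obtain ⟨b, hb, hcb⟩ := (h1.2 c c.2).1 h2
      refine add_mem (Submodule.mem_sup_left ?_) (Submodule.mem_sup_right hy')
      refine Submodule.mem_span_singleton.2 ⟨⟨b, hb⟩, ?_⟩
      rw [hg, smul_smul]
      congr 1
      exact Subtype.ext hcb.symm

/-- The component at `i` of the dot product with a fixed vector is linear over the subring. -/
lemma exists_linearMap_dot (hz : DirectSum.IsInternal fun a => Submodule.span R₀ {z a})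
    (v : Fin n → R) (i : Fin d.gam) : ∃ φ : (Fin n → R) →ₗ[R₀] R,
      ∀ u, φ u = galoisCoord R₀ z (v ⬝ᵥ u) i * z i := by
  obtain ⟨π, hπ, -⟩ := exists_projections hz
  exact ⟨π i ∘ₗ
    { toFun := fun u => v ⬝ᵥ u
      map_add' := fun x y => dotProduct_add v x y
      map_smul' := fun c x => dotProduct_smul c v x }, fun u => hπ i _⟩

lemma restrictAll [Finite R] (hR₀ : ∀ x y : R₀, x ∣ y ∨ y ∣ x)
    (hz : DirectSum.IsInternal fun a => Submodule.span R₀ {z a}) (hz' : StoresGenerators σ z)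
    {es : List ((Fin n → Cell d) × Fin d.gam)} {fs : List ((Fin n → R) × Fin d.gam)}
    (hes : List.Forall₂ (fun e f => Stores σ e.1 f.1 ∧ e.2 = f.2) es fs)
    {us : List (Fin n → Cell d)} {vs : List (Fin n → R)} (hus : StoresList σ us vs) :
    Ensures R₀ z (Comp.restrictAll es us) σ (fs.length * (vs.length * (4 * n + 8))) fun r τ =>
      ∃ vs', StoresList τ r vs' ∧ vs'.length = vs.length ∧
        ∀ x, x ∈ Submodule.span R₀ {x | x ∈ vs'} ↔ x ∈ Submodule.span R₀ {x | x ∈ vs} ∧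
          ∀ f ∈ fs, galoisCoord R₀ z (f.1 ⬝ᵥ x) f.2 * z f.2 = 0 := by
  induction es generalizing fs us vs σ with
  | nil =>
    obtain rfl := List.forall₂_nil_left_iff.1 hes
    exact pure ⟨vs, hus, rfl, by simp⟩
  | cons e es ih =>
    obtain ⟨f, fs, ⟨he, he'⟩, hes', rfl⟩ := List.forall₂_cons_left_iff.1 hes
    obtain ⟨φ, hφ⟩ := exists_linearMap_dot hz f.1 f.2
    refine weakenCost (bind (restrict hR₀ (i := e.2) (he' ▸ hφ) he hz' hus) fun us' τ hτ hr =>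
      (?_ : Ensures R₀ z _ τ (fs.length * (vs.length * (4 * n + 8))) _))
      (by rw [List.length_cons, Nat.succ_mul fs.length]; omega)
    obtain ⟨vs', h1, h2, h3⟩ := hr
    refine (ih (Stores.mono hz' hτ) (List.Forall₂.imp (fun _ _ h => ⟨h.1.mono hτ, h.2⟩) hes')
      h1).weaken (by rw [h2]) ?_
    rintro r ρ - ⟨vs'', k1, k2, k3⟩
    refine ⟨vs'', k1, k2.trans h2, fun x => ?_⟩
    rw [k3, h3, Submodule.mem_inf, LinearMap.mem_ker, hφ]
    simp [and_assoc]

/-- The multiples of the unit vectors by generators of `R` over the subring generate `R ^ n`. -/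
lemma span_generators (hz : DirectSum.IsInternal fun a => Submodule.span R₀ {z a})
    {vs : List (Fin n → R)} (h : ∀ j a, (Pi.single j (z a) : Fin n → R) ∈ vs) :
    Submodule.span R₀ {x | x ∈ vs} = ⊤ := by
  refine eq_top_iff.2 fun x _ => ?_
  rw [← Finset.univ_sum_single x]
  refine Submodule.sum_mem _ fun j _ => ?_
  obtain ⟨c, hc⟩ := exists_sum_generators hz (x j)
  have h1 : (Pi.single j (x j) : Fin n → R) = ∑ a, c a • (Pi.single j (z a) : Fin n → R) := by
    ext i
    rw [Finset.sum_apply]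
    by_cases hi : i = j
    · subst hi
      simp [hc, Subring.smul_def]
    · simp [hi]
  rw [h1]
  exact Submodule.sum_mem _ fun a _ => Submodule.smul_mem _ _ (Submodule.subset_span (h j a))

variable {k : ℕ} {A : Fin k → Fin n → Cell d} {M : Matrix (Fin k) (Fin n) R}

/-- The computation returns generators of the kernel over `R₀`, and they are used as generators
over `R`. -/
lemma kernel [Finite R] (hR₀ : ∀ x y : R₀, x ∣ y ∨ y ∣ x)
    (hz : DirectSum.IsInternal fun a => Submodule.span R₀ {z a}) (hz' : StoresGenerators σ z)
    (hA : ∀ i, Stores σ (A i) (M i)) :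
    Ensures R₀ z (Comp.kernel A) σ (2 + k * d.gam * (n * d.gam * (4 * n + 8))) fun r τ =>
      ∃ vs, StoresList τ r vs ∧ vs.length = n * d.gam ∧
        Submodule.span R {x | x ∈ vs} = LinearMap.ker M.mulVecLin := by
  refine bind zero fun o τ hτ ho => ?_
  refine (restrictAll (fs := (List.finRange k ×ˢ List.finRange d.gam).map fun e => (M e.1, e.2))
    (vs := (List.finRange n ×ˢ List.finRange d.gam).map fun e => Pi.single e.1 (z e.2))
    hR₀ hz (Stores.mono hz' hτ) ?_ ?_).weaken (by simp [List.length_product]) ?_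
  · rw [List.forall₂_map_left_iff, List.forall₂_map_right_iff]
    exact List.forall₂_same.2 fun e _ => ⟨(hA e.1).mono hτ, rfl⟩
  · rw [StoresList, List.forall₂_map_left_iff, List.forall₂_map_right_iff]
    refine List.forall₂_same.2 fun e _ j => ?_
    by_cases h : j = e.1
    · subst h
      simpa using Holds.mono (hz' e.2) hτ
    · simpa [h] using ho
  · rintro r ρ - ⟨vs, h1, h2, h3⟩
    obtain ⟨π, hπ, hπ'⟩ := exists_projections hz
    have h4 : ∀ x, x ∈ Submodule.span R₀ {x | x ∈ vs} ↔ M.mulVecLin x = 0 := by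
      intro x
      rw [h3, span_generators hz fun j a => List.mem_map.2 ⟨(j, a), by simp, rfl⟩]
      refine ⟨fun h => funext fun i => ?_, fun h => ⟨trivial, fun f hf => ?_⟩⟩
      · rw [Matrix.mulVecLin_apply, ← hπ' ((M *ᵥ x) i)]
        exact Finset.sum_eq_zero fun j _ => by
          rw [hπ]
          exact h.2 (M i, j) (List.mem_map.2 ⟨(i, j), by simp, rfl⟩)
      · obtain ⟨⟨i, j⟩, -, rfl⟩ := List.mem_map.1 hf
        have : M i ⬝ᵥ x = 0 := congrFun h i
        rw [← hπ, this, map_zero]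
    refine ⟨vs, h1, h2.trans (by simp [List.length_product]), le_antisymm
      (Submodule.span_le.2 fun x hx => (h4 x).1 (Submodule.subset_span hx)) fun x hx => ?_⟩
    exact Submodule.span_le_restrictScalars R₀ R _ ((h4 x).2 hx)

lemma findSolution [Nontrivial R] {us : List (Fin (n + 1) → Cell d)}
    {vs : List (Fin (n + 1) → R)} (hus : StoresList σ us vs) :
    Ensures R₀ z (Comp.findSolution us) σ (vs.length * 2 + (n + 3)) fun r τ => match r with
      | none => ∀ v ∈ vs, ¬ IsUnit (v (Fin.last n))
      | some x => ∃ v ∈ vs, ∃ c, v (Fin.last n) * c = -1 ∧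
          Stores τ x fun i => c * v i.castSucc := by
  induction us generalizing vs σ with
  | nil =>
    obtain rfl := List.forall₂_nil_left_iff.1 hus
    exact pure (by simp)
  | cons u us ih =>
    obtain ⟨v, vs, hu, hus', rfl⟩ := List.forall₂_cons_left_iff.1 hus
    replace hus' : StoresList σ us vs := hus'
    refine weakenCost (bind (inv (hu (Fin.last n))) fun c τ hτ hc =>
      ifZ (N := vs.length * 2 + (n + 3)) hc (fun h => ?_) fun h => ?_)
      (by rw [List.length_cons]; omega)
    · refine (ih (hus'.mono hτ)).weaken le_rfl ?_
      rintro (_ | x) ρ - hr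
      · intro w hw
        rcases List.mem_cons.1 hw with rfl | hw
        · exact Ring.not_isUnit_iff_inverse_eq_zero.2 h
        · exact hr w hw
      · obtain ⟨w, hw, hr⟩ := hr
        exact ⟨w, List.mem_cons_of_mem _ hw, hr⟩
    · refine weakenCost (bind zero fun o τ₂ h₂ ho => bind (sub ho (hc.mono h₂))
        fun c' τ₃ h₃ hc' => bind (smul hc' (v := fun i => v i.castSucc)
          fun i => (hu i.castSucc).mono ((hτ.trans h₂).trans h₃)) fun x τ₄ h₄ hx =>
            pure (N := 0) ?_)
        (by omega)
      refine ⟨v, List.mem_cons_self, _, ?_, hx⟩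
      rw [zero_sub, mul_neg, Ring.mul_inverse_cancel _ (Ring.isUnit_iff_inverse_ne_zero.2 h)]

/-- A system of linear equations has a solution if and only if the kernel of its augmented matrix
has a generator with a unit in the last entry, because nonunits form an ideal. -/
lemma solve [Finite R] [IsLocalRing R] (hR₀ : ∀ x y : R₀, x ∣ y ∨ y ∣ x)
    (hz : DirectSum.IsInternal fun a => Submodule.span R₀ {z a}) (hz' : StoresGenerators σ z)
    (hA : ∀ i, Stores σ (A i) (M i)) {b : Fin k → Cell d} {v : Fin k → R} (hb : Stores σ b v)
    {N : ℕ} (hN : 2 + k * d.gam * ((n + 1) * d.gam * (4 * (n + 1) + 8)) +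
      ((n + 1) * d.gam * 2 + (n + 3)) ≤ N) :
    Ensures R₀ z (Comp.solve A b) σ N fun r τ => match r with
      | none => ¬ ∃ x, M *ᵥ x = v
      | some y => ∃ x, M *ᵥ x = v ∧ Stores τ y x := by
  let M' : Matrix (Fin k) (Fin (n + 1)) R := fun i => Fin.snoc (α := fun _ => R) (M i) (v i)
  have hM' : ∀ x i, (M' *ᵥ x) i = (M *ᵥ fun j => x j.castSucc) i + v i * x (Fin.last n) := by
    intro x i
    simp [Matrix.mulVec, dotProduct, Fin.sum_univ_castSucc, M']
  refine weakenCost (bind (kernel (M := M') hR₀ hz hz' fun i j => ?_) fun us τ _ hus =>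
    (?_ : Ensures R₀ z _ τ ((n + 1) * d.gam * 2 + (n + 3)) _)) hN
  · cases j using Fin.lastCases with
    | last => simpa [M'] using hb i
    | cast j => simpa [M'] using hA i j
  · obtain ⟨vs, h1, h2, h3⟩ := hus
    refine (findSolution h1).weaken (by rw [h2]) ?_
    rintro (_ | y) ρ - hr
    · rintro ⟨x, hx⟩
      have h4 : (Fin.snoc (α := fun _ => R) x (-1) : Fin (n + 1) → R) ∈
          LinearMap.ker M'.mulVecLin := by
        rw [LinearMap.mem_ker, Matrix.mulVecLin_apply]
        funext i
        rw [hM']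
        simp [hx]
      rw [← h3] at h4
      have h5 : Submodule.span R {x | x ∈ vs} ≤
          Submodule.comap (LinearMap.proj (Fin.last n)) (IsLocalRing.maximalIdeal R) :=
        Submodule.span_le.2 fun v hv => hr v hv
      have h6 := h5 h4
      simp at h6
    · obtain ⟨w, hw, c, hc, hy⟩ := hr
      refine ⟨_, ?_, hy⟩
      have h4 : w ∈ LinearMap.ker M'.mulVecLin := h3 ▸ Submodule.subset_span hw
      funext i
      have h5 : (M' *ᵥ w) i = 0 := congrFun h4 i
      rw [hM'] at h5
      have h6 : (M *ᵥ fun j => c * w j.castSucc) i = c * (M *ᵥ fun j => w j.castSucc) i := by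
        have : (fun j : Fin n => c * w j.castSucc) = c • fun j : Fin n => w j.castSucc := rfl
        rw [this, Matrix.mulVec_smul, Pi.smul_apply, smul_eq_mul]
      rw [h6]
      linear_combination c * h5 - v i * hc

end Ensures

end

/-! ### Error modules and erasure solutions -/

section

variable {R S : Type*} [CommRing R] [CommRing S] [Algebra R S]

/-- An element of a Galois extension with trivial annihilator in `R` is a unit, since the elements
of the maximal ideal are annihilated by the annihilator of the maximal ideal of `R`. -/
lemma IsGaloisExtension.isUnit_of_smul_eq_zero [Finite R] [IsLocalRing R] {m : ℕ}
    (h : IsGaloisExtension R S m) {x : S} (hx : ∀ a : R, a • x = 0 → a = 0) : IsUnit x := by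
  have := h.isLocalRing
  by_contra hu
  obtain ⟨s, hs0, hs⟩ := exists_ne_zero_mul_maximalIdeal R
  refine hs0 (hx s ?_)
  have h1 : x ∈ (IsLocalRing.maximalIdeal R).map (algebraMap R S) := by
    rw [h.map_maximalIdeal]
    exact hu
  have h2 : (IsLocalRing.maximalIdeal R).map (algebraMap R S) ≤
      LinearMap.ker (LinearMap.mulLeft S (algebraMap R S s)) := by
    refine Ideal.map_le_of_le_comap fun a ha => ?_
    rw [Ideal.mem_comap]
    show algebraMap R S s * algebraMap R S a = 0
    rw [← map_mul, hs a ha, map_zero]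
  have h3 : algebraMap R S s * x = 0 := h2 h1
  rwa [Algebra.smul_def]

lemma mem_errorModule {d : Sizes} {f : Fin d.lam → S} (hf : ∀ l, IsUnit (f l))
    {s : Fin (d.n - d.k) → S} {x : S} :
    x ∈ errorModule R f s ↔ ∀ l, f l * x ∈ vecSupport R s := by
  rw [errorModule, Submodule.mem_iInf]
  refine forall_congr' fun l => ?_
  rw [shiftedSupport, Submodule.mem_map]
  constructor
  · rintro ⟨y, hy, rfl⟩
    rwa [LinearMap.mulLeft_apply, ← mul_assoc, Ring.mul_inverse_cancel _ (hf l), one_mul]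
  · intro h
    exact ⟨_, h, by rw [LinearMap.mulLeft_apply, ← mul_assoc, Ring.inverse_mul_cancel _ (hf l),
      one_mul]⟩

/-- Over a finite ring, a generating family of a free module that has as many elements as the rank
is linearly independent. -/
lemma linearIndependent_of_span_eq_of_finrank_eq {V ι : Type*} [Finite R] [Nontrivial R]
    [AddCommGroup V] [Module R V] [Finite V] [Fintype ι] {N : Submodule R V} [Module.Free R N]
    {v : ι → V} (hv : Submodule.span R (Set.range v) = N)
    (hr : Module.finrank R N = Fintype.card ι) : LinearIndependent R v := by
  have h1 : ∀ a : ι → R, ∑ i, a i • v i ∈ N := fun a => by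
    rw [← hv]
    exact Submodule.sum_mem _ fun i _ => Submodule.smul_mem _ _ (Submodule.subset_span ⟨i, rfl⟩)
  let g : (ι → R) → N := fun a => ⟨∑ i, a i • v i, h1 a⟩
  have hg : Function.Surjective g := by
    rintro ⟨x, hx⟩
    rw [← hv] at hx
    obtain ⟨a, rfl⟩ := (Submodule.mem_span_range_iff_exists_fun R).1 hx
    exact ⟨a, rfl⟩
  have hg' := (hg.bijective_of_nat_card_le (by
    rw [natCard_submodule_of_free N, hr, Nat.card_fun, Nat.card_eq_fintype_card (α := ι)])).1
  exact Fintype.linearIndependent_iffₛ.2 fun a a' h => congrFun (hg' (Subtype.ext h))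

lemma span_mul_range {ι κ : Type*} (v : ι → S) (w : κ → S) :
    Submodule.span R (Set.range v) * Submodule.span R (Set.range w) =
      Submodule.span R (Set.range fun p : ι × κ => v p.1 * w p.2) := by
  rw [Submodule.span_mul_span]
  congr 1
  ext x
  simp [Set.mem_mul]

lemma errorModule_mul_le {d : Sizes} {f : Fin d.lam → S} (hf : ∀ l, IsUnit (f l))
    {s : Fin (d.n - d.k) → S} :
    errorModule R f s * Submodule.span R (Set.range f) ≤ vecSupport R s := by
  rw [Submodule.mul_le]
  intro x hx y hy
  obtain ⟨c, rfl⟩ := (Submodule.mem_span_range_iff_exists_fun R).1 hy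
  rw [Finset.mul_sum]
  refine Submodule.sum_mem _ fun l _ => ?_
  rw [mul_smul_comm, mul_comm]
  exact Submodule.smul_mem _ _ ((mem_errorModule hf).1 hx l)

/-- If the product of two modules with generating families `v` and `w` has the rank of a free module
`N` that contains it, and this rank is the number of products `v c * w l`, then these products are
linearly independent and span `N`. -/
lemma products_basis [Finite R] [Nontrivial R] [Finite S] {ι κ : Type*} [Fintype ι]
    [Fintype κ] {v : ι → S} {w : κ → S} {N : Submodule R S} [Module.Free R N]
    (hle : Submodule.span R (Set.range v) * Submodule.span R (Set.range w) ≤ N)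
    (hfr : freeRank R ↥(Submodule.span R (Set.range v) * Submodule.span R (Set.range w)) =
      Module.finrank R N) (hcard : Module.finrank R N = Fintype.card ι * Fintype.card κ) :
    LinearIndependent R (fun p : ι × κ => v p.1 * w p.2) ∧
      Submodule.span R (Set.range fun p : ι × κ => v p.1 * w p.2) = N := by
  have h := Submodule.eq_of_le_of_freeRank_eq hle hfr
  rw [span_mul_range] at h
  exact ⟨linearIndependent_of_span_eq_of_finrank_eq h (by rw [hcard, Fintype.card_prod]), h⟩

variable {ι κ : Type*} [Fintype ι] [Fintype κ] {n k : ℕ} {v : ι → S} {w : κ → S}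

lemma mulVec_eq_sum_products {H : Matrix (Fin k) (Fin n) S} {h : Fin k → Fin n → κ → R}
    (hH : ∀ i j, H i j = ∑ l, h i j l • w l) (x : ι → Fin n → R) (i : Fin k) :
    (H *ᵥ fun j => ∑ c, x c j • v c) i =
      ∑ p : ι × κ, (∑ j, h i j p.2 * x p.1 j) • (v p.1 * w p.2) := by
  have h1 : ∀ j, (∑ l, h i j l • w l) * ∑ c, x c j • v c =
      ∑ p : ι × κ, (h i j p.2 * x p.1 j) • (v p.1 * w p.2) := by
    intro j
    rw [mul_comm, Finset.sum_mul_sum, Fintype.sum_prod_type]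
    exact Finset.sum_congr rfl fun c _ => Finset.sum_congr rfl fun l _ => by
      rw [smul_mul_smul_comm, mul_comm (x c j)]
  simp only [Matrix.mulVec, dotProduct, hH, h1, Finset.sum_smul]
  exact Finset.sum_comm

/-- In terms of the basis of products, the equation for an erasure solution splits into one linear
system for each basis element of the error module. -/
lemma mulVec_eq_iff (hvw : LinearIndependent R (fun p : ι × κ => v p.1 * w p.2))
    {H : Matrix (Fin k) (Fin n) S} {h : Fin k → Fin n → κ → R}
    (hH : ∀ i j, H i j = ∑ l, h i j l • w l) {s : Fin k → S} {t : Fin k → ι × κ → R}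
    (hs : ∀ i, s i = ∑ p, t i p • (v p.1 * w p.2)) (x : ι → Fin n → R) :
    (H *ᵥ fun j => ∑ c, x c j • v c) = s ↔ ∀ c i l, ∑ j, h i j l * x c j = t i (c, l) := by
  rw [funext_iff]
  simp only [mulVec_eq_sum_products hH, hs]
  constructor
  · intro hx c i l
    exact Fintype.linearIndependent_iffₛ.1 hvw _ _ (hx i) (c, l)
  · intro hx i
    exact Finset.sum_congr rfl fun p _ => by rw [hx p.1 i p.2]

/-- A solution with entries in the span of `v` has the whole span as support: a product
`v c * w l` is a combination of products of elements of the support with the elements `w l'`, and by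
uniqueness of coordinates `v c` is one of these elements. -/
lemma span_range_eq_of_mulVec_eq [Nonempty κ]
    (hvw : LinearIndependent R (fun p : ι × κ => v p.1 * w p.2))
    {H : Matrix (Fin k) (Fin n) S} {h : Fin k → Fin n → κ → R}
    (hH : ∀ i j, H i j = ∑ l, h i j l • w l) {e : Fin n → S}
    (he : ∀ j, e j ∈ Submodule.span R (Set.range v))
    (hs : ∀ p : ι × κ, v p.1 * w p.2 ∈ Submodule.span R (Set.range (H *ᵥ e))) :
    Submodule.span R (Set.range e) = Submodule.span R (Set.range v) := by
  classical
  have hle : Submodule.span R (Set.range e) ≤ Submodule.span R (Set.range v) :=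
    Submodule.span_le.2 (by rintro _ ⟨j, rfl⟩; exact he j)
  refine le_antisymm hle (Submodule.span_le.2 ?_)
  rintro _ ⟨c, rfl⟩
  obtain ⟨l₀⟩ := ‹Nonempty κ›
  obtain ⟨a, ha⟩ := (Submodule.mem_span_range_iff_exists_fun R).1 (hs (c, l₀))
  let y : κ → S := fun l => ∑ i, ∑ j, (a i * h i j l) • e j
  have hy : ∀ l, y l ∈ Submodule.span R (Set.range e) := fun l =>
    Submodule.sum_mem _ fun i _ => Submodule.sum_mem _ fun j _ =>
      Submodule.smul_mem _ _ (Submodule.subset_span ⟨j, rfl⟩)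
  choose q hq using fun l => (Submodule.mem_span_range_iff_exists_fun R).1 (hle (hy l))
  have h1 : v c * w l₀ = ∑ p : ι × κ, q p.2 p.1 • (v p.1 * w p.2) := by
    have h2 : v c * w l₀ = ∑ l, y l * w l := by
      have h3 : ∀ i, a i • (H *ᵥ e) i = ∑ l, (∑ j, (a i * h i j l) • e j) * w l := by
        intro i
        simp only [Matrix.mulVec, dotProduct, hH, Finset.sum_mul, Finset.smul_sum]
        rw [Finset.sum_comm]
        exact Finset.sum_congr rfl fun l _ => Finset.sum_congr rfl fun j _ => by
          rw [smul_mul_assoc, smul_mul_assoc, smul_smul, mul_comm (w l)]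
      rw [← ha]
      simp only [h3, y, Finset.sum_mul]
      exact Finset.sum_comm
    rw [h2, Fintype.sum_prod_type_right]
    exact Finset.sum_congr rfl fun l _ => by
      rw [← hq l, Finset.sum_mul]
      exact Finset.sum_congr rfl fun c' _ => by rw [smul_mul_assoc]
  have h2 : ∀ p, (Pi.single (c, l₀) 1 : ι × κ → R) p = q p.2 p.1 :=
    Fintype.linearIndependent_iffₛ.1 hvw _ _ (by
      rw [← h1, Finset.sum_eq_single (c, l₀)]
      · simp
      · intro p _ hp
        simp [hp]
      · simp)
  have h3 : v c = y l₀ := by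
    rw [← hq l₀, Finset.sum_eq_single c]
    · rw [← h2 (c, l₀)]
      simp
    · intro c' _ hc
      rw [← h2 (c', l₀)]
      simp [hc]
    · simp
  rw [h3]
  exact hy l₀

end

/-! ### The steps of the decoder -/

namespace Comp

variable {d : Sizes}

/-- Perform a computation for each entry of a list. -/
def mapList {α β : Type} (f : α → Comp d β) : List α → Comp d (List β)
  | [] => pure []
  | a :: l => do
    let x ← f a
    let xs ← mapList f l
    pure (x :: xs)

/-- The coordinates of `θ ^ m`. -/
def modulus : Fin d.m → Cell d := fun c => .inl (.modulus c)

/-- The coordinates of the basis elements of `F`. -/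
def basis : Fin d.lam → Fin d.m → Cell d := fun l c => .inl (.basis l c)

/-- The coordinates of the received word. -/
def received : Fin d.n → Fin d.m → Cell d := fun j c => .inl (.received j c)

/-- The syndrome of the received word. -/
def syndrome : Comp d (Fin (d.n - d.k) → Fin d.m → Cell d) :=
  vec fun i => dotElt modulus (fun j c => .inl (.parity i j c)) received

/-- The products of the inverses of the basis elements of `F` with the elements of a list. -/
def shiftedGenerators (us : List (Fin d.m → Cell d)) :
    Comp d (Fin d.lam → List (Fin d.m → Cell d)) :=
  vec fun l => mapList (mulElt modulus fun c => .inl (.basisInv l c)) us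

/-- Generators of the module of all `x` such that all products of `x` with basis elements of `F` are
in the span of the triangular list `B`. This is the kernel of a matrix, whose rows are indexed by a
basis element of `F` and a coordinate. -/
def intersection (B : List (Fin d.m × (Fin d.m → Cell d))) : Comp d (List (Fin d.m → Cell d)) := do
  let t ← vec fun l => do
    let xs ← shifts modulus d.m (basis l)
    vec fun c => reduce B (xs c)
  kernel fun (e : Fin (d.lam * d.m)) c => t (finProdFinEquiv.symm e).1 c (finProdFinEquiv.symm e).2

/-- The products of the elements of a list with the basis elements of `F`. -/
def products (us : List (Fin d.m → Cell d)) :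
    Comp d (Fin (us.length * d.lam) → Fin d.m → Cell d) :=
  vec fun p => mulElt modulus (us.get (finProdFinEquiv.symm p).1) (basis (finProdFinEquiv.symm p).2)

/-- The coordinates of an element `u` with respect to the elements `w j`. -/
def coordinates {n : ℕ} (w : Fin n → Fin d.m → Cell d) (u : Fin d.m → Cell d) :
    Comp d (Option (Fin n → Cell d)) :=
  solve (fun a j => w j a) u

/-- Solve the erasure decoding problem with syndrome `s` for the module spanned by the list `us`,
where `w` holds the products of its elements with the basis elements of `F`. The entries of the
parity-check matrix and of the syndrome are expressed through the basis elements of `F` and through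
the products, and then there is one linear system for each entry of `us`. The cell `.inr 0` is a
placeholder for coordinates that do not exist. -/
def erasure (s : Fin (d.n - d.k) → Fin d.m → Cell d) (us : List (Fin d.m → Cell d))
    (w : Fin (us.length * d.lam) → Fin d.m → Cell d) :
    Comp d (Option (Fin d.n → Fin d.m → Cell d)) := do
  let h ← vec fun i => vec fun j => coordinates basis fun c => .inl (.parity i j c)
  let t ← vec fun i => coordinates w (s i)
  let x ← vec fun c => solve
    (fun (e : Fin ((d.n - d.k) * d.lam)) j =>
      (h (finProdFinEquiv.symm e).1 j).getD (fun _ => .inr 0) (finProdFinEquiv.symm e).2)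
    fun e => (t (finProdFinEquiv.symm e).1).getD (fun _ => .inr 0)
      (finProdFinEquiv (c, (finProdFinEquiv.symm e).2))
  if ∀ c, (x c).isSome = true then do
    let e ← vec fun j => linComb (fun c => (x c).getD (fun _ => .inr 0) j) us.get
    pure (some e)
  else pure none

end Comp

section

variable {R S : Type*} [CommRing R] [CommRing S] [Algebra R S] {d : Sizes} {R₀ : Subring R}
  {z : Fin d.gam → R} {σ τ : MemState d R} {n : ℕ}

/-- The list `us` holds the coordinates of the elements `ss`. -/
def StoresElts (b : Module.Basis (Fin n) R S) (σ : MemState d R) (us : List (Fin n → Cell d))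
    (ss : List S) : Prop :=
  List.Forall₂ (fun u s => Stores σ u (b.equivFun s)) us ss

/-- The input cells hold the input of the decoder. -/
structure InputsStored (σ : MemState d R) (θ : S) (b : Module.Basis (Fin d.m) R S)
    (H : Matrix (Fin (d.n - d.k)) (Fin d.n) S) (f : Fin d.lam → S) (r : Fin d.n → S)
    (z : Fin d.gam → R) : Prop where
  modulus : Stores σ Comp.modulus (b.equivFun (θ ^ d.m))
  parity : ∀ i j, Stores σ (fun c => .inl (.parity i j c)) (b.equivFun (H i j))
  basis : ∀ l, Stores σ (Comp.basis l) (b.equivFun (f l))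
  basisInv : ∀ l, Stores σ (fun c => .inl (.basisInv l c)) (b.equivFun (Ring.inverse (f l)))
  received : ∀ j, Stores σ (Comp.received j) (b.equivFun (r j))
  generator : StoresGenerators σ z

/-- The properties of the input of the decoder that its analysis uses. -/
structure IsValidInput (R₀ : Subring R) (z : Fin d.gam → R) (θ : S)
    (b : Module.Basis (Fin d.m) R S) (H : Matrix (Fin (d.n - d.k)) (Fin d.n) S)
    (f : Fin d.lam → S) : Prop where
  basis_eq : ∀ i, b i = θ ^ (i : ℕ)
  dvd_total : ∀ x y : R₀, x ∣ y ∨ y ∣ x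
  isInternal : DirectSum.IsInternal fun a => Submodule.span R₀ {z a}
  isUnit : ∀ l, IsUnit (f l)
  mem_span : ∀ i j, H i j ∈ Submodule.span R (Set.range f)
  m_pos : 0 < d.m
  gam_pos : 0 < d.gam
  lam_pos : 0 < d.lam
  lam_le : d.lam ≤ d.m
  n_pos : 0 < d.n

lemma StoresElts.mono {b : Module.Basis (Fin n) R S} {us : List (Fin n → Cell d)} {ss : List S}
    (h : StoresElts b σ us ss) (hl : σ ≤ τ) : StoresElts b τ us ss :=
  List.Forall₂.imp (fun _ _ h => h.mono hl) h

lemma StoresElts.storesList {b : Module.Basis (Fin n) R S} {us : List (Fin n → Cell d)}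
    {ss : List S} (h : StoresElts b σ us ss) : StoresList σ us (ss.map b.equivFun) := by
  rwa [StoresList, List.forall₂_map_right_iff]

lemma StoresElts.ofFn {b : Module.Basis (Fin n) R S} {k : ℕ} {x : Fin k → Fin n → Cell d}
    {v : Fin k → S} (h : ∀ i, Stores σ (x i) (b.equivFun (v i))) :
    StoresElts b σ (List.ofFn x) (List.ofFn v) := by
  induction k with
  | zero => simp [StoresElts]
  | succ k ih =>
    rw [List.ofFn_succ, List.ofFn_succ]
    exact List.Forall₂.cons (h 0) (ih fun i => h i.succ)

lemma StoresElts.exists_ofFn {b : Module.Basis (Fin n) R S} {us : List (Fin n → Cell d)}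
    {ss : List S} (h : StoresElts b σ us ss) : ∃ v : Fin us.length → S, ss = List.ofFn v ∧
      ∀ i, Stores σ (us.get i) (b.equivFun (v i)) := by
  induction us generalizing ss with
  | nil =>
    obtain rfl := List.forall₂_nil_left_iff.1 h
    exact ⟨Fin.elim0, rfl, fun i => i.elim0⟩
  | cons u us ih =>
    obtain ⟨s, ss, hs, hss, rfl⟩ := List.forall₂_cons_left_iff.1 h
    obtain ⟨v, rfl, hv⟩ := ih hss
    refine ⟨Fin.cons s v, by simp [List.ofFn_succ], fun i => ?_⟩
    refine Fin.cases hs hv i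

lemma span_mem_ofFn {V : Type*} [AddCommGroup V] [Module R V] {k : ℕ} (v : Fin k → V) :
    Submodule.span R {x | x ∈ List.ofFn v} = Submodule.span R (Set.range v) := by
  congr 1
  ext x
  exact List.mem_ofFn' v x

lemma span_mem_map {V W : Type*} [AddCommGroup V] [Module R V] [AddCommGroup W] [Module R W]
    (e : V →ₗ[R] W) (l : List V) :
    Submodule.span R {x | x ∈ l.map e} = (Submodule.span R {x | x ∈ l}).map e := by
  rw [Submodule.map_span]
  congr 1
  ext v
  simp

lemma List.map_equiv_map_symm {V W : Type*} [AddCommGroup V] [Module R V] [AddCommGroup W]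
    [Module R W] (e : V ≃ₗ[R] W) (l : List W) : (l.map e.symm).map e = l := by
  simp [Function.comp_def]

lemma linearIndependent_get_of_map {V W : Type*} [AddCommGroup V] [Module R V] [AddCommGroup W]
    [Module R W] (e : V →ₗ[R] W) {l : List V} (h : LinearIndependent R (l.map e).get) :
    LinearIndependent R l.get := by
  have h1 := h.comp (Fin.cast (List.length_map (f := e) (as := l)).symm) (Fin.cast_injective _)
  refine LinearIndependent.of_comp e ?_
  convert h1 using 1
  funext i
  simp

namespace InputsStored

variable {θ : S} {b : Module.Basis (Fin d.m) R S} {H : Matrix (Fin (d.n - d.k)) (Fin d.n) S}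
  {f : Fin d.lam → S} {r : Fin d.n → S}

lemma mono (h : InputsStored σ θ b H f r z) (hl : σ ≤ τ) : InputsStored τ θ b H f r z :=
  ⟨h.1.mono hl, fun i j => (h.2 i j).mono hl, fun l => (h.3 l).mono hl, fun l => (h.4 l).mono hl,
    fun j => (h.5 j).mono hl, Stores.mono h.6 hl⟩

lemma initialMemory : InputsStored ⟨initialMemory θ b H f r z, 0⟩ θ b H f r z :=
  ⟨fun _ => ⟨trivial, rfl⟩, fun _ _ _ => ⟨trivial, rfl⟩, fun _ _ => ⟨trivial, rfl⟩,
    fun _ _ => ⟨trivial, rfl⟩, fun _ _ => ⟨trivial, rfl⟩, fun _ => ⟨trivial, rfl⟩⟩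

end InputsStored

namespace Ensures

lemma mapList {α β : Type} {V : Type*} {P : α → V → Prop} {Q : β → V → MemState d R → Prop}
    {f : α → Comp d β} {N : ℕ} (hQ : ∀ x v τ ρ, τ ≤ ρ → Q x v τ → Q x v ρ)
    (hf : ∀ a v τ, σ ≤ τ → P a v → Ensures R₀ z (f a) τ N fun x ρ => Q x v ρ)
    {l : List α} {vs : List V} (hl : List.Forall₂ P l vs) :
    Ensures R₀ z (Comp.mapList f l) σ (vs.length * N)
      fun xs ρ => List.Forall₂ (fun x v => Q x v ρ) xs vs := by
  induction hl generalizing σ with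
  | nil => exact pure List.Forall₂.nil
  | @cons a v l vs h _ ih =>
    exact weakenCost (bind (hf a v σ le_rfl h) fun x τ hτ hx => bind
      (ih fun a v ρ hρ => hf a v ρ (hτ.trans hρ)) fun xs ρ hρ hxs => pure (N := 0)
      (List.Forall₂.cons (hQ _ _ _ _ hρ hx) hxs))
      (by rw [List.length_cons, Nat.succ_mul vs.length]; omega)

/-- Elimination determines the free rank of the span `N` of a list of elements and whether `N` is
free. If `N` is free, it yields a basis of `N` and, with the reduction `red`, a linear test for
membership in `N`. -/
lemma echelonElts [Finite R] [IsLocalRing R] {b : Module.Basis (Fin n) R S}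
    {us : List (Fin n → Cell d)} {ss : List S} (hus : StoresElts b σ us ss) {N : Submodule R S}
    (hN : Submodule.span R {x | x ∈ ss} = N) :
    Ensures R₀ z (Comp.echelon us) σ (ss.length * (4 * n ^ 2 + 4 * n)) fun a τ =>
      a.1.length = freeRank R N ∧ a.1.length ≤ n ∧ (a.2 = true ↔ Module.Free R N) ∧
      ∃ C bs, StoresPivots τ a.1 C ∧ StoresElts b τ (a.1.map Prod.snd) bs ∧
        (Module.Free R N → ListIsBasis R bs N ∧
          ∀ x, red C (b.equivFun x) = 0 ↔ x ∈ N) := by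
  refine (echelon hus.storesList).weaken (by rw [List.length_map]) ?_
  rintro ⟨B, t⟩ τ - ⟨C, h1, h2, h3⟩
  have hM : Submodule.span R {v | v ∈ ss.map b.equivFun} = N.map b.equivFun.toLinearMap := by
    rw [← hN, ← span_mem_map]
    rfl
  rw [hM] at h2 h3
  have e := b.equivFun.submoduleMap N
  have hlen : B.length = C.length := h1.length_eq
  have hfree : t = true ↔ Module.Free R N := by
    rw [h3, ← h2.free_iff]
    exact ⟨fun h => Module.Free.of_equiv e.symm, fun h => Module.Free.of_equiv e⟩
  refine ⟨?_, ?_, hfree, C, (C.map Prod.snd).map b.equivFun.symm, h1, ?_, ?_⟩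
  · rw [freeRank_congr e, hlen]
    exact h2.freeRank_eq.symm
  · exact hlen.trans_le h2.triangular.length_le
  · have h4 := h1.storesList
    rwa [← List.map_equiv_map_symm b.equivFun (C.map Prod.snd), StoresList,
      List.forall₂_map_right_iff] at h4
  · intro h
    have hspan : spanVec C = N.map b.equivFun.toLinearMap := h3.1 (hfree.2 h)
    refine ⟨⟨linearIndependent_get_of_map b.equivFun.toLinearMap ?_, ?_⟩, fun x => ?_⟩
    · have : ((C.map Prod.snd).map b.equivFun.symm).map b.equivFun.toLinearMap =
          C.map Prod.snd := List.map_equiv_map_symm b.equivFun _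
      rw [this]
      exact h2.triangular.linearIndependent
    · have h4 := span_mem_map b.equivFun.symm.toLinearMap (C.map Prod.snd)
      rw [show Submodule.span R {x | x ∈ C.map Prod.snd} = _ from hspan, ← Submodule.map_comp,
        LinearEquiv.coe_toLinearMap, LinearEquiv.symm_comp, Submodule.map_id] at h4
      exact h4
    · rw [h2.triangular.red_eq_zero_iff, hspan]
      simp

variable {θ : S} {b : Module.Basis (Fin d.m) R S} {H : Matrix (Fin (d.n - d.k)) (Fin d.n) S}
  {f : Fin d.lam → S} {r : Fin d.n → S} {s : Fin (d.n - d.k) → S}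

lemma syndrome (hv : IsValidInput R₀ z θ b H f) (hσ : InputsStored σ θ b H f r z) :
    Ensures R₀ z Comp.syndrome σ
      ((d.n - d.k) * (d.n * (6 * d.m ^ 2) + d.m * (d.n + 2))) fun s τ =>
        ∀ i, Stores τ (s i) (b.equivFun ((H *ᵥ r) i)) :=
  vecStores fun i _ hτ => dotElt hv.basis_eq (hσ.modulus.mono hτ)
    (fun j => (hσ.parity i j).mono hτ) fun j => (hσ.received j).mono hτ

lemma shiftedGenerators (hv : IsValidInput R₀ z θ b H f) (hσ : InputsStored σ θ b H f r z)
    {us : List (Fin d.m → Cell d)} {ss : List S} (hus : StoresElts b σ us ss)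
    (hs : ListSpans R ss (vecSupport R s)) :
    Ensures R₀ z (Comp.shiftedGenerators us) σ (d.lam * (ss.length * (6 * d.m ^ 2))) fun g τ =>
      ∃ gs : Fin d.lam → List S, ∀ l, StoresElts b τ (g l) (gs l) ∧
        ListSpans R (gs l) (shiftedSupport R (f l) s) := by
  refine (vec (Q := fun l g τ => StoresElts b τ g (ss.map fun x => Ring.inverse (f l) * x))
    (fun _ _ _ _ hl h => h.mono hl) fun l τ hτ => ?_).weaken le_rfl fun g τ _ hg =>
      ⟨_, fun l => ⟨hg l, ?_⟩⟩
  · simp only [StoresElts, List.forall₂_map_right_iff]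
    exact mapList (Q := fun x v ρ => Stores ρ x (b.equivFun (Ring.inverse (f l) * v)))
      (fun _ _ _ _ hl h => h.mono hl) (fun u x ρ hρ hu => mulElt hv.basis_eq
        (hσ.modulus.mono (hτ.trans hρ)) ((hσ.basisInv l).mono (hτ.trans hρ)) (hu.mono hρ))
      (hus.mono hτ |>.imp fun _ _ h => h)
  · rw [shiftedSupport, ← hs, ← span_mem_map]
    rfl

end Ensures

end

section

variable {R S : Type*} [CommRing R] [CommRing S] [Algebra R S] {d : Sizes} {R₀ : Subring R}
  {z : Fin d.gam → R} {σ τ : MemState d R} {θ : S} {b : Module.Basis (Fin d.m) R S}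
  {H : Matrix (Fin (d.n - d.k)) (Fin d.n) S} {f : Fin d.lam → S} {r : Fin d.n → S}
  {s : Fin (d.n - d.k) → S}

/-- The cost of `Comp.solve` for `k ≤ k'` equations in `n ≤ n'` unknowns. The bounds `k'` and `n'`
are positive where `k` and `n` may vanish, so that the constant terms can be absorbed. -/
lemma solve_cost_le {k k' n n' γ : ℕ} (hk : k ≤ k') (hn : n ≤ n') (hk' : 0 < k') (hn' : 0 < n')
    (hγ : 0 < γ) : 2 + k * γ * ((n + 1) * γ * (4 * (n + 1) + 8)) +
      ((n + 1) * γ * 2 + (n + 3)) ≤ 50 * (k' * n' ^ 2 * γ ^ 2) := by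
  have h1 : k * γ * ((n + 1) * γ * (4 * (n + 1) + 8)) ≤
      k' * γ * ((2 * n') * γ * (16 * n')) := by gcongr <;> omega
  have h2 : (n + 1) * γ * 2 ≤ (2 * n') * γ * 2 := by gcongr; omega
  have h3 : n' * γ ≤ k' * n' ^ 2 * γ ^ 2 := by
    calc n' * γ = 1 * (n' * 1) * (γ * 1) := by ring
      _ ≤ k' * (n' * n') * (γ * γ) := by gcongr <;> omega
      _ = _ := by ring
  have h4 : n' * 1 ≤ n' * γ := by gcongr; omega
  calc _ ≤ 2 + k' * γ * ((2 * n') * γ * (16 * n')) + ((2 * n') * γ * 2 + (n + 3)) := by gcongr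
    _ = 32 * (k' * n' ^ 2 * γ ^ 2) + 4 * (n' * γ) + (n + 5) := by ring
    _ ≤ _ := by omega

namespace Ensures

lemma intersection [Finite R] [IsLocalRing R] (hv : IsValidInput R₀ z θ b H f)
    (hσ : InputsStored σ θ b H f r z) {B : List (Fin d.m × (Fin d.m → Cell d))}
    {C : List (Fin d.m × (Fin d.m → R))} (hB : StoresPivots σ B C) (hlen : B.length ≤ d.m)
    (hC : ∀ x, red C (b.equivFun x) = 0 ↔ x ∈ vecSupport R s) :
    Ensures R₀ z (Comp.intersection B) σ (18 * (d.lam * d.m ^ 3 * d.gam ^ 2)) fun g τ =>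
      ∃ gs, StoresElts b τ g gs ∧ gs.length = d.m * d.gam ∧
        ListSpans R gs (errorModule R f s) := by
  have hcost : C.length * (2 * d.m) ≤ 2 * d.m ^ 2 := by
    rw [← hB.length_eq]
    calc _ ≤ d.m * (2 * d.m) := by gcongr
      _ = _ := by ring
  have hm := hv.m_pos
  have hγ := hv.gam_pos
  have hl := hv.lam_pos
  refine weakenCost (bind (vec (N := 4 * d.m ^ 3)
    (Q := fun l t τ => ∀ c : Fin d.m, Stores τ (t c) (red C (b.equivFun (f l * θ ^ (c : ℕ)))))
    (fun _ _ _ _ hle h c => Stores.mono (h c) hle) fun l τ hτ => ?_) fun t τ hτ ht =>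
      (kernel (M := Matrix.of fun (e : Fin (d.lam * d.m)) (c : Fin d.m) =>
        red C (b.equivFun (f (finProdFinEquiv.symm e).1 * θ ^ (c : ℕ)))
          (finProdFinEquiv.symm e).2) hv.dvd_total hv.isInternal (hσ.mono hτ).generator
        fun e c => ht _ c _).weaken le_rfl fun g ρ _ hg => ?_) ?_
  · refine weakenCost (bind (shifts hv.basis_eq (hσ.modulus.mono hτ) ((hσ.basis l).mono hτ))
      fun xs ρ hρ hxs => vecStores fun c π hπ => reduce (hB.mono ((hτ.trans hρ).trans hπ))
        ((hxs c).mono hπ)) ?_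
    calc d.m * (2 * d.m) + d.m * (C.length * (2 * d.m))
        ≤ d.m * (2 * d.m) + d.m * (2 * d.m ^ 2) := by gcongr
      _ = 2 * (d.m ^ 2 * 1) + 2 * d.m ^ 3 := by ring
      _ ≤ 2 * (d.m ^ 2 * d.m) + 2 * d.m ^ 3 := by gcongr; omega
      _ = 4 * d.m ^ 3 := by ring
  · obtain ⟨vs, h1, h2, h3⟩ := hg
    refine ⟨vs.map b.equivFun.symm, ?_, by rw [List.length_map, h2], ?_⟩
    · rwa [← List.map_equiv_map_symm b.equivFun vs, StoresList, List.forall₂_map_right_iff] at h1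
    · have h4 := span_mem_map b.equivFun.symm.toLinearMap vs
      rw [h3] at h4
      refine h4.trans ?_
      ext x
      rw [Submodule.mem_map_equiv, LinearEquiv.symm_symm, LinearMap.mem_ker, mem_errorModule
        hv.isUnit, Matrix.mulVecLin_apply]
      have h5 : ∀ l, red C (b.equivFun (f l * x)) =
          fun a => ∑ c : Fin d.m, red C (b.equivFun (f l * θ ^ (c : ℕ))) a * b.equivFun x c := by
        intro l
        funext a
        conv_lhs => rw [← b.sum_equivFun x, Finset.mul_sum]
        simp only [mul_smul_comm, map_sum, map_smul, Finset.sum_apply, Pi.smul_apply, smul_eq_mul,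
          hv.basis_eq, mul_comm]
      simp only [← hC, h5]
      constructor
      · intro h l
        funext a
        have := congrFun h (finProdFinEquiv (l, a))
        simpa only [Matrix.mulVec, dotProduct, Matrix.of_apply, Equiv.symm_apply_apply,
          Pi.zero_apply] using this
      · intro h
        funext e
        exact congrFun (h _) _
  · have h1 : d.m ^ 3 * 1 ≤ d.m ^ 3 * d.gam ^ 2 := by gcongr; exact Nat.one_le_pow _ _ hγ
    have h2 : 1 ≤ d.lam * d.m ^ 3 * d.gam ^ 2 := Nat.succ_le_of_lt (by positivity)
    calc d.lam * (4 * d.m ^ 3) + (2 + d.lam * d.m * d.gam * (d.m * d.gam * (4 * d.m + 8)))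
        ≤ d.lam * (4 * (d.m ^ 3 * d.gam ^ 2)) + (2 * (d.lam * d.m ^ 3 * d.gam ^ 2) +
          d.lam * d.m * d.gam * (d.m * d.gam * (12 * d.m))) := by
          gcongr <;> omega
      _ = _ := by ring

lemma products (hv : IsValidInput R₀ z θ b H f) (hσ : InputsStored σ θ b H f r z)
    {us : List (Fin d.m → Cell d)} {v : Fin us.length → S}
    (hus : ∀ i, Stores σ (us.get i) (b.equivFun (v i))) :
    Ensures R₀ z (Comp.products us) σ (us.length * d.lam * (6 * d.m ^ 2)) fun w τ =>
      ∀ p, Stores τ (w p) (b.equivFun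
        (v (finProdFinEquiv.symm p).1 * f (finProdFinEquiv.symm p).2)) :=
  vecStores fun _ _ hτ => mulElt hv.basis_eq (hσ.modulus.mono hτ) ((hus _).mono hτ)
    ((hσ.basis _).mono hτ)

lemma coordinates [Finite R] [IsLocalRing R] (hv : IsValidInput R₀ z θ b H f)
    (hσ : InputsStored σ θ b H f r z) {n n' : ℕ} {w : Fin n → Fin d.m → Cell d} {ws : Fin n → S}
    (hw : ∀ j, Stores σ (w j) (b.equivFun (ws j))) {u : Fin d.m → Cell d} {x : S}
    (hu : Stores σ u (b.equivFun x)) (hx : x ∈ Submodule.span R (Set.range ws)) (hn : n ≤ n')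
    (hn' : 0 < n') :
    Ensures R₀ z (Comp.coordinates w u) σ (50 * (d.m * n' ^ 2 * d.gam ^ 2)) fun t τ =>
      ∃ a : Fin n → R, Stores τ (t.getD fun _ => .inr 0) a ∧ x = ∑ j, a j • ws j := by
  have key : ∀ a : Fin n → R,
      (Matrix.of fun i j => b.equivFun (ws j) i) *ᵥ a = b.equivFun (∑ j, a j • ws j) := by
    intro a
    funext i
    simp [Matrix.mulVec, dotProduct, mul_comm, Finset.sum_apply]
  refine (solve (M := Matrix.of fun i j => b.equivFun (ws j) i) hv.dvd_total hv.isInternal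
    hσ.generator (fun i j => hw j i) hu
    (solve_cost_le le_rfl hn hv.m_pos hn' hv.gam_pos)).weaken le_rfl ?_
  rintro (_ | y) τ - ht
  · obtain ⟨a, ha⟩ := (Submodule.mem_span_range_iff_exists_fun R).1 hx
    exact absurd ⟨a, by rw [key, ha]⟩ ht
  · obtain ⟨a, ha, hy⟩ := ht
    refine ⟨a, hy, ?_⟩
    rw [key] at ha
    exact (b.equivFun.injective ha).symm

lemma erasure [Finite R] [IsLocalRing R] (hv : IsValidInput R₀ z θ b H f)
    (hσ : InputsStored σ θ b H f r z) {x : Fin (d.n - d.k) → Fin d.m → Cell d}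
    (hx : ∀ i, Stores σ (x i) (b.equivFun (s i))) {us : List (Fin d.m → Cell d)}
    {v : Fin us.length → S} (hus : ∀ i, Stores σ (us.get i) (b.equivFun (v i)))
    {w : Fin (us.length * d.lam) → Fin d.m → Cell d}
    (hw : ∀ p, Stores σ (w p) (b.equivFun
      (v (finProdFinEquiv.symm p).1 * f (finProdFinEquiv.symm p).2)))
    (hvE : Submodule.span R (Set.range v) = errorModule R f s)
    (hind : LinearIndependent R fun p : Fin us.length × Fin d.lam => v p.1 * f p.2)
    (hspan : Submodule.span R (Set.range fun p : Fin us.length × Fin d.lam => v p.1 * f p.2) =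
      vecSupport R s) (hlen : us.length * d.lam ≤ d.m) :
    Ensures R₀ z (Comp.erasure x us w) σ
      (50 * (d.n ^ 2 * d.m * d.lam ^ 2 * d.gam ^ 2) + 50 * (d.n * d.m ^ 3 * d.gam ^ 2) +
        50 * (d.lam * d.m * d.n ^ 3 * d.gam ^ 2) + 4 * (d.n * d.m ^ 2)) fun t τ => match t with
      | none => ¬ ∃ e, IsErasureSolution R f H s e
      | some e => ∃ es, (∀ j, Stores τ (e j) (b.equivFun (es j))) ∧
          IsErasureSolution R f H s es := by
  have hlam : Nonempty (Fin d.lam) := ⟨⟨0, hv.lam_pos⟩⟩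
  have hlen' : us.length ≤ d.m := (Nat.le_mul_of_pos_right _ hv.lam_pos).trans hlen
  have hnk : d.n - d.k ≤ d.n := Nat.sub_le _ _
  refine weakenCost (bind (vec (N := d.n * (50 * (d.m * d.lam ^ 2 * d.gam ^ 2)))
    (Q := fun i h τ => ∀ j, ∃ a : Fin d.lam → R,
      Stores τ ((h j).getD fun _ => .inr 0) a ∧ H i j = ∑ l, a l • f l)
    (fun i h τ ρ hl hh j => (hh j).imp fun a ha => ⟨ha.1.mono hl, ha.2⟩)
    fun i τ hτ => vec (fun j h τ ρ hl hh => hh.imp fun a ha => ⟨ha.1.mono hl, ha.2⟩)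
      fun j ρ hρ => coordinates hv (hσ.mono (hτ.trans hρ))
        (fun l => (hσ.basis l).mono (hτ.trans hρ)) ((hσ.parity i j).mono (hτ.trans hρ))
        (hv.mem_span i j) le_rfl hv.lam_pos)
    fun h τ₁ h₁ hh => bind (vec (N := 50 * (d.m * d.m ^ 2 * d.gam ^ 2))
      (Q := fun i t τ => ∃ a : Fin (us.length * d.lam) → R,
        Stores τ (t.getD fun _ => .inr 0) a ∧ s i = ∑ p, a p •
          (v (finProdFinEquiv.symm p).1 * f (finProdFinEquiv.symm p).2))
      (fun i t τ ρ hl hh => hh.imp fun a ha => ⟨ha.1.mono hl, ha.2⟩)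
      fun i τ hτ => coordinates hv (hσ.mono (h₁.trans hτ)) (fun p => (hw p).mono (h₁.trans hτ))
        ((hx i).mono (h₁.trans hτ)) ?_ hlen hv.m_pos)
    fun t τ₂ h₂ ht => (?_ : Ensures R₀ z _ τ₂ (d.m * (50 * (d.lam * d.n * d.n ^ 2 * d.gam ^ 2)) +
      d.n * (d.m * (2 * d.m + 2))) _)) ?_
  · have h1 : s i ∈ vecSupport R s := Submodule.subset_span ⟨i, rfl⟩
    rw [← hspan] at h1
    convert h1 using 2
    exact finProdFinEquiv.symm.surjective.range_comp
      fun p : Fin us.length × Fin d.lam => v p.1 * f p.2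
  · choose a ha haH using hh
    choose c hc hcs using ht
    -- The system for the coordinates of a solution at the entry `q` of the list.
    let M : Matrix (Fin ((d.n - d.k) * d.lam)) (Fin d.n) R := fun e j =>
      a (finProdFinEquiv.symm e).1 j (finProdFinEquiv.symm e).2
    let y : Fin us.length → Fin ((d.n - d.k) * d.lam) → R := fun q e =>
      c (finProdFinEquiv.symm e).1 (finProdFinEquiv (q, (finProdFinEquiv.symm e).2))
    have hsol : ∀ X : Fin us.length → Fin d.n → R,
        (H *ᵥ fun j => ∑ q, X q j • v q) = s ↔ ∀ q, M *ᵥ X q = y q := by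
      intro X
      rw [mulVec_eq_iff hind haH (t := fun i p => c i (finProdFinEquiv p)) (fun i => by
        rw [hcs i, ← finProdFinEquiv.sum_comp]
        simp) X]
      refine forall_congr' fun q => ⟨fun hq => funext fun e => hq _ _, fun hq i l => ?_⟩
      have := congrFun hq (finProdFinEquiv (i, l))
      simpa only [M, y, Matrix.mulVec, dotProduct, Equiv.symm_apply_apply] using this
    refine weakenCost (bind (vec (Q := fun q t τ => match t with
        | none => ¬ ∃ X, M *ᵥ X = y q
        | some u => ∃ X, M *ᵥ X = y q ∧ Stores τ u X) ?_ fun q τ hτ =>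
      (solve (M := M) (v := y q) hv.dvd_total hv.isInternal
        (hσ.mono ((h₁.trans h₂).trans hτ)).generator
        (fun e j => (ha (finProdFinEquiv.symm e).1 j).mono (h₂.trans hτ) (finProdFinEquiv.symm e).2)
        (fun e => (hc (finProdFinEquiv.symm e).1).mono hτ
          (finProdFinEquiv (q, (finProdFinEquiv.symm e).2)))
        (solve_cost_le (k' := d.lam * d.n) ((Nat.mul_le_mul_right _ hnk).trans_eq (mul_comm _ _))
          le_rfl (Nat.mul_pos hv.lam_pos hv.n_pos) hv.n_pos hv.gam_pos)).weaken
          le_rfl (by rintro (_ | u) ρ - hu <;> exact hu))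
      (N' := d.n * (d.m * (2 * d.m + 2))) fun X τ₃ h₃ hX => ?_) (by gcongr)
    · rintro q (_ | u) τ ρ hl hu
      · exact hu
      · exact hu.imp fun X hX => ⟨hX.1, hX.2.mono hl⟩
    split_ifs with hsome
    · have hX' : ∀ q, ∃ Z, M *ᵥ Z = y q ∧ Stores τ₃ ((X q).getD fun _ => .inr 0) Z := by
        intro q
        have h1 := hX q
        obtain ⟨u, hu⟩ := Option.isSome_iff_exists.1 (hsome q)
        rw [hu] at h1 ⊢
        exact h1
      choose Z hZ hZX using hX'
      refine weakenCost (bind (vecStores (v := fun j => b.equivFun (∑ q, Z q j • v q))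
        fun j ρ hρ => (linComb (fun q => (hZX q).mono hρ j)
          fun q => (hus q).mono (((h₁.trans h₂).trans h₃).trans hρ)).weaken
            (N' := d.m * (2 * d.m + 2)) (by gcongr) fun e π _ he => by
            simpa only [map_sum, map_smul] using he)
        fun e ρ _ he => pure (N := 0) ⟨_, he, ?_, (hsol Z).2 hZ⟩) (by omega)
      rw [← hvE]
      refine span_range_eq_of_mulVec_eq hind haH (fun j => Submodule.sum_mem _ fun q _ =>
        Submodule.smul_mem _ _ (Submodule.subset_span ⟨q, rfl⟩)) fun p => ?_
      rw [(hsol Z).2 hZ]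
      exact hspan.le (Submodule.subset_span ⟨p, rfl⟩)
    · refine pure ?_
      rintro ⟨e, he, hes⟩
      refine hsome fun q => ?_
      have he' : ∀ j, e j ∈ Submodule.span R (Set.range v) := fun j => by
        rw [hvE, ← he]
        exact Submodule.subset_span ⟨j, rfl⟩
      choose Z hZ using fun j => (Submodule.mem_span_range_iff_exists_fun R).1 (he' j)
      obtain rfl : (fun j => ∑ q, Z j q • v q) = e := funext hZ
      have h1 := (hsol fun q j => Z j q).1 hes q
      have h2 := hX q
      cases h : X q with
      | none =>
        rw [h] at h2
        exact absurd ⟨_, h1⟩ h2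
      | some u => rfl
  · have hm := hv.m_pos
    calc (d.n - d.k) * (d.n * (50 * (d.m * d.lam ^ 2 * d.gam ^ 2))) +
          ((d.n - d.k) * (50 * (d.m * d.m ^ 2 * d.gam ^ 2)) +
            (d.m * (50 * (d.lam * d.n * d.n ^ 2 * d.gam ^ 2)) + d.n * (d.m * (2 * d.m + 2))))
        ≤ d.n * (d.n * (50 * (d.m * d.lam ^ 2 * d.gam ^ 2))) +
          (d.n * (50 * (d.m * d.m ^ 2 * d.gam ^ 2)) +
            (d.m * (50 * (d.lam * d.n * d.n ^ 2 * d.gam ^ 2)) + d.n * (d.m * (4 * d.m)))) := by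
          gcongr
          omega
      _ = _ := by ring

end Ensures

end

/-! ### The decoder -/

namespace Comp

variable {d : Sizes}

/-- The last steps of the decoder, once bases `bs` of the support of the syndrome and `us` of the
error module are known. -/
def decodeIntersection (s : Fin (d.n - d.k) → Fin d.m → Cell d) (bs : List (Fin d.m → Cell d))
    (gi : Fin d.lam → List (Fin d.m → Cell d)) (g us : List (Fin d.m → Cell d)) :
    Comp d (Trace d (Fin d.m → Cell d)) :=
  if us.length = bs.length / d.lam then do
    let w ← products us
    let B ← echelon (List.ofFn w)
    if B.1.length = bs.length then do
      match ← erasure s us w with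
      | none => pure (.noErasureSolution s bs gi g us)
      | some e => do
        let out ← vec fun j => vec fun c => op (.sub (received j c) (e j c))
        pure (.success s bs gi g us e out)
    else pure (.rankMismatch s bs gi g us)
  else pure (.rankMismatch s bs gi g us)

/-- The steps of the decoder that follow the computation of a triangular basis `B` of the support of
the syndrome. -/
def decodeSupport (s : Fin (d.n - d.k) → Fin d.m → Cell d)
    (B : List (Fin d.m × (Fin d.m → Cell d))) : Comp d (Trace d (Fin d.m → Cell d)) :=
  if d.lam ∣ B.length then do
    let gi ← shiftedGenerators (B.map Prod.snd)
    let g ← intersection B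
    let E ← echelon g
    if E.2 = true then decodeIntersection s (B.map Prod.snd) gi g (E.1.map Prod.snd)
    else pure (.intersectionNotFree s (B.map Prod.snd) gi g)
  else pure (.rankNotDivisible s (B.map Prod.snd))

/-- The decoding algorithm. At every node of the tree the lengths of the lists of cells are known,
so that decisions which depend on ranks only need no operations. -/
def decoder : Comp d (Trace d (Fin d.m → Cell d)) := do
  let s ← syndrome
  let t ← all fun i => isZero (s i)
  if t = true then pure (.zeroSyndrome s received)
  else do
    let B ← echelon (List.ofFn s)
    if B.2 = true then decodeSupport s B.1 else pure (.supportNotFree s)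

end Comp

section

variable {R S : Type*} [CommRing R] [CommRing S] [Algebra R S] {d : Sizes} {R₀ : Subring R}
  {z : Fin d.gam → R} {σ τ : MemState d R} {θ : S} {b : Module.Basis (Fin d.m) R S}
  {H : Matrix (Fin (d.n - d.k)) (Fin d.n) S} {f : Fin d.lam → S} {r : Fin d.n → S}
  {s : Fin (d.n - d.k) → S} {F : Submodule R S}

lemma Stores.readElement_eq {x : Fin d.m → Cell d} {u : S} (h : Stores σ x (b.equivFun u)) :
    readElement b σ.mem x = u := by
  rw [readElement, ← b.sum_equivFun u]
  exact Finset.sum_congr rfl fun c _ => by rw [(h c).2]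

lemma readElement_comp_eq {ι : Type*} {x : ι → Fin d.m → Cell d} {u : ι → S}
    (h : ∀ i, Stores σ (x i) (b.equivFun (u i))) : readElement b σ.mem ∘ x = u :=
  funext fun i => (h i).readElement_eq

lemma StoresElts.map_readElement {us : List (Fin d.m → Cell d)} {ss : List S}
    (h : StoresElts b σ us ss) : us.map (readElement b σ.mem) = ss := by
  induction h with
  | nil => rfl
  | cons h _ ih => rw [List.map_cons, h.readElement_eq, ih]

lemma freeRank_eq_finrank [Finite R] [Nontrivial R] [Finite S] (N : Submodule R S)
    [Module.Free R N] : freeRank R N = Module.finrank R N := by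
  have v := Module.finBasis R N
  refine freeRank_eq_of_smul (s := (1 : R)) one_ne_zero (b := fun i => (v i : S))
    (v.linearIndependent.map' N.subtype N.ker_subtype) (fun i => (v i).2) fun x hx => ⟨x, ?_, rfl⟩
  have h1 : (⟨x, hx⟩ : N) ∈ Submodule.span R (Set.range v) := by
    rw [v.span_eq]
    trivial
  have h2 := Submodule.mem_map_of_mem (f := N.subtype) h1
  rwa [Submodule.map_span, ← Set.range_comp] at h2

lemma ListIsBasis.finrank_eq [Nontrivial R] {l : List S} {N : Submodule R S}
    (h : ListIsBasis R l N) : Module.finrank R N = l.length := by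
  obtain ⟨h₁, rfl⟩ := h
  have := finrank_span_eq_card h₁
  rwa [Set.range_list_get, Fintype.card_fin] at this

namespace Ensures

lemma decodeIntersection [Finite R] [IsLocalRing R] [Finite S] (hv : IsValidInput R₀ z θ b H f)
    (hF : Submodule.span R (Set.range f) = F) (hσ : InputsStored σ θ b H f r z)
    {x : Fin (d.n - d.k) → Fin d.m → Cell d} (hx : ∀ i, Stores σ (x i) (b.equivFun (s i)))
    {bs : List (Fin d.m → Cell d)} {bss : List S} (hbs : StoresElts b σ bs bss)
    {gi : Fin d.lam → List (Fin d.m → Cell d)} {gis : Fin d.lam → List S}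
    (hgi : ∀ l, StoresElts b σ (gi l) (gis l)) {g : List (Fin d.m → Cell d)} {gs : List S}
    (hg : StoresElts b σ g gs) {us : List (Fin d.m → Cell d)} {uss : List S}
    (hus : StoresElts b σ us uss) (h : PassedIntersectionTest R f H r s bss gis gs uss)
    (hlen : bs.length ≤ d.m) :
    Ensures R₀ z (Comp.decodeIntersection x bs gi g us) σ
      (14 * d.m ^ 3 + (50 * (d.n ^ 2 * d.m * d.lam ^ 2 * d.gam ^ 2) +
        50 * (d.n * d.m ^ 3 * d.gam ^ 2) + 50 * (d.lam * d.m * d.n ^ 3 * d.gam ^ 2) +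
        4 * (d.n * d.m ^ 2)) + d.n * d.m)
      fun t τ => IsDecoderRun R F f H r (t.map (readElement b τ.mem)) := by
  have hread : ∀ τ, σ ≤ τ → readElement b τ.mem ∘ x = s ∧ bs.map (readElement b τ.mem) = bss ∧
      (fun l => (gi l).map (readElement b τ.mem)) = gis ∧ g.map (readElement b τ.mem) = gs ∧
      us.map (readElement b τ.mem) = uss := fun τ hτ =>
    ⟨readElement_comp_eq fun i => (hx i).mono hτ, (hbs.mono hτ).map_readElement,
      funext fun l => ((hgi l).mono hτ).map_readElement, (hg.mono hτ).map_readElement,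
      (hus.mono hτ).map_readElement⟩
  have hfree := h.1.1.2.2.1
  have hν : Module.finrank R (vecSupport R s) = bs.length := by
    rw [h.1.1.2.2.2.finrank_eq, hbs.length_eq]
  have hν' : freeRank R (vecSupport R s) = bs.length := by rw [freeRank_eq_finrank, hν]
  have ht : freeRank R (errorModule R f s) = us.length := by
    have := h.2.1
    rw [freeRank_eq_finrank, h.2.2.finrank_eq, hus.length_eq]
  have hmis : ∀ τ, σ ≤ τ → ¬ RanksMatch R F f s → IsDecoderRun R F f H r
      ((Trace.rankMismatch x bs gi g us).map (readElement b τ.mem)) := fun τ hτ hne => by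
    obtain ⟨e1, e2, e3, e4, e5⟩ := hread τ hτ
    simp only [Trace.map, e1, e2, e3, e4, e5]
    exact ⟨h, hne⟩
  have hm := hv.m_pos
  unfold Comp.decodeIntersection
  split_ifs with h0
  · have htl : us.length * d.lam = bs.length := by
      rw [h0]
      exact Nat.div_mul_cancel (hν' ▸ h.1.2.1)
    obtain ⟨v, huv, hvs⟩ := hus.exists_ofFn
    have hvE : Submodule.span R (Set.range v) = errorModule R f s := by
      rw [← span_mem_ofFn, ← huv]
      exact h.2.2.2
    have hprod : Submodule.span R {y | y ∈ List.ofFn fun p : Fin (us.length * d.lam) =>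
        v (finProdFinEquiv.symm p).1 * f (finProdFinEquiv.symm p).2} =
        errorModule R f s * F := by
      rw [span_mem_ofFn, ← hvE, ← hF, span_mul_range]
      congr 1
      exact finProdFinEquiv.symm.surjective.range_comp
        fun p : Fin us.length × Fin d.lam => v p.1 * f p.2
    refine weakenCost (bind (products hv hσ hvs) fun w τ₁ h₁ hw => bind (echelonElts
      (StoresElts.ofFn hw) hprod) fun B τ₂ h₂ hB => (?_ : Ensures R₀ z _ τ₂ ((50 *
        (d.n ^ 2 * d.m * d.lam ^ 2 * d.gam ^ 2) + 50 * (d.n * d.m ^ 3 * d.gam ^ 2) +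
        50 * (d.lam * d.m * d.n ^ 3 * d.gam ^ 2) + 4 * (d.n * d.m ^ 2)) + d.n * d.m) _)) ?_
    · split_ifs with h3
      · have hmatch : RanksMatch R F f s :=
          ⟨by rw [ht, hν', h0], by rw [← hB.1, h3, hν']⟩
        obtain ⟨hind, hspan⟩ := products_basis (v := v) (w := f) (N := vecSupport R s)
          (by rw [hvE]; exact errorModule_mul_le hv.isUnit)
          (by rw [hvE, hF, ← hB.1, h3, hν]) (by simp [hν, htl])
        have hσ₂ := h₁.trans h₂
        refine weakenCost (bind (erasure hv (hσ.mono hσ₂) (fun i => (hx i).mono hσ₂)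
          (fun i => (hvs i).mono hσ₂) (fun p => (hw p).mono h₂) hvE hind hspan (htl.trans_le hlen))
          (N' := d.n * d.m) fun t τ₃ h₄ hres => ?_) le_rfl
        rcases t with _ | e
        · refine pure ?_
          obtain ⟨e1, e2, e3, e4, e5⟩ := hread _ (hσ₂.trans h₄)
          simp only [Trace.map, e1, e2, e3, e4, e5]
          exact ⟨h, hmatch, hres⟩
        · obtain ⟨es, hes, hsol⟩ := hres
          refine weakenCost (bind (vecStores (N := d.m * 1)
            (v := fun j => b.equivFun (r j - es j)) fun j τ hτ => vecCells fun c ρ hρ =>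
              (sub ((hσ.received j c).mono (((hσ₂.trans h₄).trans hτ).trans hρ))
                ((hes j c).mono (hτ.trans hρ))).weaken le_rfl fun _ _ _ h => by
                rwa [map_sub, Pi.sub_apply])
            fun out τ₅ h₅ hout => pure (N := 0) ?_) (by simp)
          obtain ⟨e1, e2, e3, e4, e5⟩ := hread _ ((hσ₂.trans h₄).trans h₅)
          simp only [Trace.map, e1, e2, e3, e4, e5]
          rw [readElement_comp_eq hout, readElement_comp_eq fun j => (hes j).mono h₅]
          exact ⟨h, hmatch, hsol, rfl⟩
      · refine pure (hmis _ (h₁.trans h₂) fun hr => h3 ?_)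
        rw [hB.1, hr.2, hν']
    · have h4 : us.length * d.lam * (6 * d.m ^ 2) ≤ d.m * (6 * d.m ^ 2) :=
        Nat.mul_le_mul_right _ (htl.trans_le hlen)
      have h5 : us.length * d.lam * (4 * d.m ^ 2 + 4 * d.m) ≤
          d.m * (4 * d.m ^ 2 + 4 * (d.m * d.m)) := by
        gcongr
        · exact htl.trans_le hlen
        · exact Nat.le_mul_of_pos_left _ hm
      rw [List.length_ofFn]
      have h6 : d.m * (6 * d.m ^ 2) + d.m * (4 * d.m ^ 2 + 4 * (d.m * d.m)) = 14 * d.m ^ 3 := by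
        ring
      omega
  · refine pure (hmis _ le_rfl fun hr => h0 ?_)
    rw [← ht, hr.1, hν']

lemma decodeSupport [Finite R] [IsLocalRing R] [Finite S] (hv : IsValidInput R₀ z θ b H f)
    (hF : Submodule.span R (Set.range f) = F) (hσ : InputsStored σ θ b H f r z)
    {x : Fin (d.n - d.k) → Fin d.m → Cell d} (hx : ∀ i, Stores σ (x i) (b.equivFun (s i)))
    {B : List (Fin d.m × (Fin d.m → Cell d))} {C : List (Fin d.m × (Fin d.m → R))}
    (hB : StoresPivots σ B C) {bss : List S} (hbs : StoresElts b σ (B.map Prod.snd) bss)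
    (hlen : B.length ≤ d.m) (hC : ∀ x, red C (b.equivFun x) = 0 ↔ x ∈ vecSupport R s)
    (h : PassedFreeTest R H r s bss) :
    Ensures R₀ z (Comp.decodeSupport x B) σ
      (6 * (d.lam * d.m ^ 3) + 18 * (d.lam * d.m ^ 3 * d.gam ^ 2) + 8 * (d.m ^ 3 * d.gam) +
        (14 * d.m ^ 3 + (50 * (d.n ^ 2 * d.m * d.lam ^ 2 * d.gam ^ 2) +
        50 * (d.n * d.m ^ 3 * d.gam ^ 2) + 50 * (d.lam * d.m * d.n ^ 3 * d.gam ^ 2) +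
        4 * (d.n * d.m ^ 2)) + d.n * d.m))
      fun t τ => IsDecoderRun R F f H r (t.map (readElement b τ.mem)) := by
  have hfree := h.2.2.1
  have hlen' : bss.length = B.length := by rw [← hbs.length_eq, List.length_map]
  have hν : freeRank R (vecSupport R s) = B.length := by
    rw [freeRank_eq_finrank, h.2.2.2.finrank_eq, hlen']
  have hm := hv.m_pos
  unfold Comp.decodeSupport
  split_ifs with h0
  · refine weakenCost (bind (shiftedGenerators hv hσ hbs h.2.2.2.2) fun gi τ₁ h₁ hgi =>
      bind (intersection hv (hσ.mono h₁) (hB.mono h₁) hlen hC) fun g τ₂ h₂ hg =>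
        (?_ : Ensures R₀ z _ τ₂ (8 * (d.m ^ 3 * d.gam) + (14 * d.m ^ 3 + (50 *
        (d.n ^ 2 * d.m * d.lam ^ 2 * d.gam ^ 2) + 50 * (d.n * d.m ^ 3 * d.gam ^ 2) +
        50 * (d.lam * d.m * d.n ^ 3 * d.gam ^ 2) + 4 * (d.n * d.m ^ 2)) + d.n * d.m)) _)) ?_
    · obtain ⟨gis, hgi⟩ := hgi
      obtain ⟨gs, hg, hgl, hgs⟩ := hg
      have hpass : PassedDivisibilityTest R f H r s bss gis gs :=
        ⟨h, hν ▸ h0, fun l => (hgi l).2, hgs⟩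
      refine weakenCost (bind (echelonElts hg hgs) fun E τ₃ h₃ hE =>
        (?_ : Ensures R₀ z _ τ₃ (14 * d.m ^ 3 + (50 *
        (d.n ^ 2 * d.m * d.lam ^ 2 * d.gam ^ 2) + 50 * (d.n * d.m ^ 3 * d.gam ^ 2) +
        50 * (d.lam * d.m * d.n ^ 3 * d.gam ^ 2) + 4 * (d.n * d.m ^ 2)) + d.n * d.m) _)) ?_
      · obtain ⟨-, -, hE, C', us, -, hus, hE'⟩ := hE
        have hσ₃ := (h₁.trans h₂).trans h₃
        split_ifs with h4
        · exact decodeIntersection hv hF (hσ.mono hσ₃) (fun i => (hx i).mono hσ₃) (hbs.mono hσ₃)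
            (fun l => (hgi l).1.mono (h₂.trans h₃)) (hg.mono h₃) hus
            ⟨hpass, hE.1 h4, (hE' (hE.1 h4)).1⟩ (by rwa [List.length_map])
        · refine pure ?_
          simp only [Trace.map, readElement_comp_eq fun i => (hx i).mono hσ₃,
            (hbs.mono hσ₃).map_readElement, (hg.mono h₃).map_readElement,
            ((hgi _).1.mono (h₂.trans h₃)).map_readElement]
          exact ⟨hpass, fun hf => h4 (hE.2 hf)⟩
      · rw [hgl]
        have : d.m * d.gam * (4 * d.m ^ 2 + 4 * d.m) ≤
            d.m * d.gam * (4 * d.m ^ 2 + 4 * (d.m * d.m)) := by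
          gcongr
          exact Nat.le_mul_of_pos_left _ hm
        have h6 : d.m * d.gam * (4 * d.m ^ 2 + 4 * (d.m * d.m)) = 8 * (d.m ^ 3 * d.gam) := by ring
        omega
    · have : d.lam * (bss.length * (6 * d.m ^ 2)) ≤ d.lam * (d.m * (6 * d.m ^ 2)) := by
        rw [hlen']
        gcongr
      have h6 : d.lam * (d.m * (6 * d.m ^ 2)) = 6 * (d.lam * d.m ^ 3) := by ring
      omega
  · refine pure ?_
    simp only [Trace.map, readElement_comp_eq hx, hbs.map_readElement]
    exact ⟨h, hν ▸ h0⟩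

/-- All terms of the cost are bounded by multiples of the claimed bound, because `lam ≤ m` and
`m * n ≤ max (n ^ 2) (m ^ 2)`. -/
lemma decoder_cost_le {m n lam gam : ℕ} (hm : 0 < m) (hn : 0 < n) (hl : 0 < lam) (hg : 0 < gam)
    (hlm : lam ≤ m) : n * (n * (6 * m ^ 2) + m * (n + 2)) + (n * m + (n * (4 * m ^ 2 + 4 * m) +
      (6 * (lam * m ^ 3) + 18 * (lam * m ^ 3 * gam ^ 2) + 8 * (m ^ 3 * gam) +
        (14 * m ^ 3 + (50 * (n ^ 2 * m * lam ^ 2 * gam ^ 2) + 50 * (n * m ^ 3 * gam ^ 2) +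
          50 * (lam * m * n ^ 3 * gam ^ 2) + 4 * (n * m ^ 2)) + n * m)))) ≤
      300 * (lam * gam ^ 4 * m * n * max (n ^ 2) (m ^ 2)) := by
  set X := max (n ^ 2) (m ^ 2)
  have hX1 : n ^ 2 ≤ X := le_max_left _ _
  have hX2 : m ^ 2 ≤ X := le_max_right _ _
  have hX3 : n * m ≤ X := by
    rcases le_total n m with h | h
    · exact le_trans (by rw [pow_two]; gcongr) hX2
    · exact le_trans (by rw [pow_two]; gcongr) hX1
  have hl1 : 1 ≤ lam := hl
  have hn1 : 1 ≤ n := hn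
  have hm1 : 1 ≤ m := hm
  have hg0 : 1 ≤ gam ^ 4 := Nat.one_le_pow _ _ hg
  have hg1 : gam ≤ gam ^ 4 := Nat.le_self_pow (by norm_num) gam
  have hg2 : gam ^ 2 ≤ gam ^ 4 := Nat.pow_le_pow_right hg (by norm_num)
  set T := lam * gam ^ 4 * m * n * X with hT
  have a1 : 1 * 1 * m * n * (n * m) ≤ T := by rw [hT]; gcongr
  have a2 : lam * gam ^ 2 * m * 1 * m ^ 2 ≤ T := by rw [hT]; gcongr
  have a3 : 1 * gam * m * 1 * m ^ 2 ≤ T := by rw [hT]; gcongr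
  have a4 : 1 * 1 * m * 1 * m ^ 2 ≤ T := by rw [hT]; gcongr
  have a5 : lam * gam ^ 2 * m * n * (n * lam) ≤ T := by
    rw [hT]
    gcongr
    exact le_trans (by gcongr) hX3
  have a6 : 1 * gam ^ 2 * m * n * m ^ 2 ≤ T := by rw [hT]; gcongr
  have a7 : lam * gam ^ 2 * m * n * n ^ 2 ≤ T := by rw [hT]; gcongr
  have a8 : lam * 1 * m * 1 * m ^ 2 ≤ T := by rw [hT]; gcongr
  have b1 : n * 1 * m ^ 2 ≤ n * n * m ^ 2 := by gcongr
  have b2 : n * 1 * (m * 1) ≤ n * n * (m * m) := by gcongr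
  have b3 : n * n * (m * 1) ≤ n * n * (m * m) := by gcongr
  ring_nf at a1 a2 a3 a4 a5 a6 a7 a8 b1 b2 b3 ⊢
  omega

/-- The decoder runs as specified, within the claimed number of operations. -/
lemma decoder [Finite R] [IsLocalRing R] [Finite S] (hv : IsValidInput R₀ z θ b H f)
    (hF : Submodule.span R (Set.range f) = F) (hσ : InputsStored σ θ b H f r z) :
    Ensures R₀ z Comp.decoder σ
      (300 * (d.lam * d.gam ^ 4 * d.m * d.n * max (d.n ^ 2) (d.m ^ 2)))
      fun t τ => IsDecoderRun R F f H r (t.map (readElement b τ.mem)) := by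
  have hnk : d.n - d.k ≤ d.n := Nat.sub_le _ _
  refine weakenCost (bind ((syndrome hv hσ).weakenCost (Nat.mul_le_mul_right _ hnk))
    fun x τ₁ h₁ hx => bind ((all (P := fun i => (H *ᵥ r) i = 0) (N := d.m) fun i τ hτ =>
      (isZero ((hx i).mono hτ)).weaken le_rfl fun t _ _ ht => ?_).weakenCost
        (Nat.mul_le_mul_right _ hnk)) fun t τ₂ h₂ ht =>
      (?_ : Ensures R₀ z _ τ₂ (_ + _) _)) (decoder_cost_le hv.m_pos hv.n_pos hv.lam_pos hv.gam_pos
        hv.lam_le)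
  · rw [ht, LinearEquiv.map_eq_zero_iff]
  · have hx₂ := fun i => (hx i).mono h₂
    split_ifs with h0
    · refine pure ?_
      simp only [Trace.map, readElement_comp_eq hx₂,
        readElement_comp_eq fun j => (hσ.received j).mono (h₁.trans h₂)]
      exact ⟨rfl, funext (ht.1 h0), rfl⟩
    · have hs0 : H *ᵥ r ≠ 0 := fun h => h0 (ht.2 fun i => congrFun h i)
      refine bind ((echelonElts (StoresElts.ofFn hx₂) (N := vecSupport R (H *ᵥ r))
        (span_mem_ofFn _)).weakenCost ?_) fun B τ₃ h₃ hB => ?_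
      · rw [List.length_ofFn]
        exact Nat.mul_le_mul_right _ hnk
      · obtain ⟨-, hlen, hfree, C, bs, hBC, hbs, hB⟩ := hB
        have hx₃ := fun i => (hx₂ i).mono h₃
        split_ifs with h4
        · exact decodeSupport hv hF (hσ.mono ((h₁.trans h₂).trans h₃)) hx₃ hBC hbs hlen
            (hB (hfree.1 h4)).2 ⟨rfl, hs0, hfree.1 h4, (hB (hfree.1 h4)).1⟩
        · refine pure ?_
          simp only [Trace.map, readElement_comp_eq hx₃]
          exact ⟨rfl, hs0, fun hf => h4 (hfree.2 hf)⟩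

end Ensures

end

theorem mainTheorem5 :
    ∃ C : ℕ, ∀ d : Sizes, ∃ P : Prog d (Trace d (Fin d.m → Cell d)),
      ∀ (R : Type*) [CommRing R] [Finite R] [IsLocalRing R]
        (S : Type*) [CommRing S] [Algebra R S] (_ : IsGaloisExtension R S d.m)
        (θ : S) (b : Module.Basis (Fin d.m) R S) (_ : ∀ i, b i = θ ^ (i : ℕ))
        (R₀ : Subring R) (_ : IsMaximalGaloisSubring R₀)
        (_ : (⊤ : Submodule R₀ R).spanFinrank = d.gam)
        (z : Fin d.gam → R) (_ : DirectSum.IsInternal fun a => Submodule.span R₀ {z a})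
        (F : Submodule R S) (H : Matrix (Fin (d.n - d.k)) (Fin d.n) S)
        (_ : IsLRPC R d.k d.n d.lam F H)
        (f : Module.Basis (Fin d.lam) R F) (r : Fin d.n → S),
        ∃ (out : Trace d (Fin d.m → Cell d)) (mem : Cell d → R) (cost : ℕ),
          P.run R₀ z (initialMemory θ b H (fun l => (f l : S)) r z) = (out, mem, cost) ∧
          IsDecoderRun R F (fun l => (f l : S)) H r (out.map (readElement b mem)) ∧
          cost ≤ C * (d.lam * d.gam ^ 4 * d.m * d.n * max (d.n ^ 2) (d.m ^ 2)) := by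
  refine ⟨300, fun d => ⟨(Comp.decoder 0).bind fun p => .halt p.1, ?_⟩⟩
  intro R _ _ _ S _ _ hS θ b hb R₀ hR₀ _ z hz F H hH f r
  have : Finite S := Finite.of_equiv _ b.equivFun.symm.toEquiv
  have : Module.Finite R S := Module.Finite.of_basis b
  have hf : LinearIndependent R fun l => (f l : S) :=
    f.linearIndependent.map' F.subtype F.ker_subtype
  have hF : Submodule.span R (Set.range fun l => (f l : S)) = F := by
    have h1 := congrArg (Submodule.map F.subtype) f.span_eq
    rwa [Submodule.map_span, ← Set.range_comp, Submodule.map_top, Submodule.range_subtype] at h1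
  have hlm : d.lam ≤ d.m := by
    simpa [Module.finrank_eq_card_basis b] using hf.fintype_card_le_finrank
  have hγ : 0 < d.gam := by
    refine Nat.pos_of_ne_zero fun h => ?_
    obtain ⟨c, hc⟩ := exists_sum_generators hz 1
    have : IsEmpty (Fin d.gam) := h ▸ Fin.isEmpty
    simp at hc
  have hv : IsValidInput R₀ z θ b H fun l => (f l : S) :=
    { basis_eq := hb
      dvd_total := hR₀.dvd_total
      isInternal := hz
      isUnit := fun l => hS.isUnit_of_smul_eq_zero fun a ha => by
        have := Fintype.linearIndependent_iff.1 hf (Pi.single l a) (by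
          rw [Finset.sum_eq_single l]
          · simpa using ha
          · intro l' _ hl
            simp [hl]
          · simp) l
        simpa using this
      mem_span := fun i j => by
        rw [hF, ← hH.span_entries]
        exact Submodule.subset_span ⟨i, j, rfl⟩
      m_pos := hH.lam_pos.trans_le hlm
      gam_pos := hγ
      lam_pos := hH.lam_pos
      lam_le := hlm
      n_pos := hH.k_pos.trans hH.k_lt }
  obtain ⟨-, hcost, hrun⟩ := Ensures.decoder (r := r) hv hF InputsStored.initialMemory
  refine ⟨_, _, _, Prog.run_bind _ _ _, hrun, ?_⟩
  simpa [Prog.run] using hcost
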